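/- Setting. Let $G$ be a locally compact, second countable (Hausdorff) group with left Haar measure $\beta$ (written $dx$, $|E|=\beta(E)$) and modular function $\Delta$, $\beta(Ex)=\Delta(x)\beta(E)$. Let $w:G\to(0,\infty)$ be continuous with $w(xy)\le w(x)w(y)$ and $w(x^{-1})=w(x)$, and let $m:G\to(0,\infty)$ be continuous with $m(xy)\le w(x)m(y)$ and $m(xy)\le m(x)w(y)$. Write $\|f\|_{L_{p,w}}=(\int_G|wf|^p\,dx)^{1/p}$. Let $\pi$ be a strongly continuous unitary representation of $G$ on a separable complex Hilbert space $\mathcal H$ and $u\in\mathcal H$ such that $Vv(x)=\langle v,\pi(x)u\rangle$ defines an isometry $V:\mathcal H\to L_2(G)$, and assume that $K=Vu$ lies in $L_{p,w}(G)$ for all $1<p<\infty$. Let $\mathcal S_w=\{v\in\mathcal H: Vv\in L_{p,w}(G)\ \forall\,1<p<\infty\}$ with the topology of the seminorms $\|Vv\|_{L_{p,w}}$, let $\mathcal S_w'$ be its antilinear topological dual (containing $\mathcal H$ via $h\mapsto\langle h,\cdot\rangle$), and put $V_eT(x)=\langle T,\pi(x)u\rangle$ for $T\in\mathcal S_w'$.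 Fix $1<r<\infty$ and let $$\mathrm{Co}(L_{r,m})=\{T\in\mathcal S_w': V_eT\in L_{r,m}(G)\},\qquad \|T\|_{\mathrm{Co}(L_{r,m})}=\|V_eT\|_{L_{r,m}}.$$ Write $\lambda(x)K(y)=K(x^{-1}y)$ and assume that $\mathrm{span}\{\lambda(x)K\}_{x\in G}$ is dense in $\mathcal M_{r,m}=\{f\in L_{r,m}(G): f*K=f\}$. Discretization. For $n\in\mathbb N$ let $Y_n\subset G$ be countable with $Y_n\subset Y_{n+1}$, $\overline{\bigcup_nY_n}=G$, and let $Q_n$ be a compact neighbourhood of $e$ with $G=\bigcup_{x\in Y_n}xQ_n$. Assume there are an integer $\mathcal I$ independent of $n$ and sets $Z_{n,i}$ with $Y_n=\bigcup_{i=1}^{\mathcal I}Z_{n,i}$ such that for $x,y\in Z_{n,i}$ one has $xQ_n\cap yQ_n\ne\emptyset$ iff $x=y$. Let $(\psi_{n,x})_{x\in Y_n}$ be measurable functions with $0\le\psi_{n,x}\le1$, $\sum_{x\in Y_n}\psi_{n,x}\equiv1$, $\mathrm{supp}\,\psi_{n,x}\subset xQ_n$, linearly independent as a.e. defined functions. Let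 $X_n\subset Y_n$ be finite with $X_n\subset X_{n+1}$ and $\overline{\bigcup_nX_n}=G$. Define $T_nF=\sum_{x\in X_n}\big(\int_GF\,\psi_{n,x}\,dy\big)\lambda(x)K$ for $F\in L_{r,m}(G)$, and let $V_n$ be the range of $T_n$. Put $\mathrm{osc}_{Q}K(x)=\sup_{v\in Q}|K(vx)-K(x)|$. Theorem. Assume that for some $1\le p<r$ one has $K\in L_{p,w\Delta^{-1/p}}(G)$ and $\mathrm{osc}_{Q_n}K\in L_{p,w}(G)\cap L_{p,w\Delta^{-1/p}}(G)$ for all $n\in\mathbb N$. (i) For every $T\in\mathrm{Co}(L_{r,m})$ and any choice of linear right inverses $S_n:V_n\to L_{r,m}(G)$ of $T_n:L_{r,m}(G)\to V_n$ there are coefficients $c(T)_{n,x}\in\mathbb C$ ($n\in\mathbb N$, $x\in X_n$), and for every $\varepsilon>0$ there is $n^*=n^*_{T,\varepsilon}$, depending only on $T$ and $\varepsilon$ and not on the $S_n$, such that for all $n\ge n^*$ $$\Big\|T-\sum_{x\in X_n}c(T)_{n,x}\,\pi(x)u\Big\|_{\mathrm{Co}(L_{r,m})}\le\varepsilon,\qquad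 \Big(\sum_{x\in X_n}|c(T)_{n,x}|^rm(x)^r\Big)^{1/r}\le C_n(1+\varepsilon)\|T\|_{\mathrm{Co}(L_{r,m})},$$ where $C_n=|Q_n|^{1-1/r}\cdot\sup_{q\in Q_n}w(q)\cdot\|S_n\|$. (ii) Let $1/q+1/p=1+1/r$, $n\in\mathbb N$ and $d=(d_x)_{x\in Y_n}\in\ell_{q,m}(Y_n)$, i.e. $\|d\|_{\ell_{q,m}}=(\sum_{x\in Y_n}|d_x|^qm(x)^q)^{1/q}<\infty$. Then the series $T=\sum_{x\in Y_n}d_x\,\pi(x)u$ converges unconditionally, both pointwise on $\mathcal S_w$ and in the norm of $\mathrm{Co}(L_{r,m})$, to an element of $\mathrm{Co}(L_{r,m})$, and $$\|T\|_{\mathrm{Co}(L_{r,m})}\le D_n\,\|d\|_{\ell_{q,m}},\qquad D_n=|Q_n|^{\frac1q-1}\cdot\mathcal I^{\,1-\frac1q}\cdot\sup_{y\in Q_n}w(y)\cdot\theta_n,$$ $$\theta_n=\max\big\{\|\mathrm{osc}_{Q_n}(K)+|K|\|_{L_{p,w}},\ \|\mathrm{osc}_{Q_n}(K)+|K|\|_{L_{p,w\Delta^{-1/p}}}\big\}.$$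 -/

import Mathlib

open MeasureTheory Filter Topology Set
open scoped ENNReal NNReal Pointwise

set_option linter.unusedSectionVars false

noncomputable section

namespace Coorbit

/-! ### Weighted Lebesgue spaces -/

section WeightedLp

variable {G : Type*} [MeasurableSpace G] {E : Type*} [NormedAddCommGroup E]

/-- The measure `w ^ p dβ`. For `w > 0` it has the null sets of `β`, and the `L_p` norm with
respect to it is `(∫ |w f| ^ p dβ) ^ (1 / p)`. -/
def weightedMeasure (β : Measure G) (p : ℝ) (w : G → ℝ) : Measure G :=
  β.withDensity fun x => ENNReal.ofReal (w x ^ p)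

/-- `f ∈ L_{p,w}`. -/
def MemLpw (β : Measure G) (p : ℝ) (w : G → ℝ) (f : G → E) : Prop :=
  MemLp f (ENNReal.ofReal p) (weightedMeasure β p w)

/-- The norm `‖f‖_{L_{p,w}}` of a function. -/
def normLpw (β : Measure G) (p : ℝ) (w : G → ℝ) (f : G → E) : ℝ :=
  (eLpNorm f (ENNReal.ofReal p) (weightedMeasure β p w)).toReal

/-- The space `L_{p,w}` of classes of complex functions. -/
abbrev Lpw (β : Measure G) (p : ℝ) (w : G → ℝ) : Type _ :=
  Lp ℂ (ENNReal.ofReal p) (weightedMeasure β p w)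

instance factOneLeOfReal (p : ℝ) [h : Fact (1 < p)] : Fact ((1 : ℝ≥0∞) ≤ ENNReal.ofReal p) :=
  ⟨by simpa using ENNReal.ofReal_le_ofReal h.out.le⟩

/-- The `Q`-oscillation `sup_{u ∈ Q} |f (u x) - f x|`. -/
def osc [Mul G] (Q : Set G) (f : G → ℂ) (x : G) : ℝ := ⨆ u : Q, ‖f (u * x) - f x‖

end WeightedLp

/-- The modular function `Δ`, normalised by `β (E x) = Δ x * β E` for a left Haar measure `β`;
Mathlib's `modularCharacterFun` is its inverse. -/
def modularFunction {G : Type*} [Group G] [TopologicalSpace G] [IsTopologicalGroup G]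
    [LocallyCompactSpace G] (x : G) : ℝ :=
  ((Measure.modularCharacterFun x : ℝ≥0) : ℝ)⁻¹

/-- `m` is a `w`-moderate weight. -/
structure IsModerate {G : Type*} [Group G] [TopologicalSpace G] (w m : G → ℝ) : Prop where
  continuous : Continuous m
  pos : ∀ x, 0 < m x
  left : ∀ x y, m (x * y) ≤ w x * m y
  right : ∀ x y, m (x * y) ≤ m x * w y

/-! ### The reproducing representation -/

/-- A control weight `w` on `G` and a strongly continuous unitary representation `π` of `G` on `H`
with a vector `u` such that `v ↦ (x ↦ ⟨v, π x u⟩)` is an isometry into `L_2(G)` and such that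
the kernel `x ↦ ⟨u, π x u⟩` lies in `L_{p,w}(G)` for all `1 < p < ∞`.
(The inner product of Mathlib is linear in its second entry.) -/
structure Setting {G : Type*} [Group G] [TopologicalSpace G] [MeasurableSpace G]
    (β : Measure G) (H : Type*) [NormedAddCommGroup H] [InnerProductSpace ℂ H] where
  w : G → ℝ
  w_continuous : Continuous w
  w_pos : ∀ x, 0 < w x
  w_mul : ∀ x y, w (x * y) ≤ w x * w y
  w_inv : ∀ x, w x⁻¹ = w x
  π : G →* (H ≃ₗᵢ[ℂ] H)
  π_continuous : ∀ v, Continuous fun x => π x v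
  u : H
  isometry : ∀ v, eLpNorm (fun x => inner ℂ (π x u) v) 2 β = ‖v‖ₑ
  kernel_mem : ∀ p : ℝ, 1 < p → MemLpw β p w fun x => inner ℂ (π x u) u

section Theory

variable {G : Type*} [Group G] [TopologicalSpace G] [IsTopologicalGroup G]
  [MeasurableSpace G] [BorelSpace G] {β : Measure G}
  {H : Type*} [NormedAddCommGroup H] [InnerProductSpace ℂ H]

/-- Left translates of functions in `L_{p,w}` lie in `L_{p,m}` if `m` is `w`-moderate. -/
theorem memLpw_translate [β.IsMulLeftInvariant] {E : Type*} [NormedAddCommGroup E] {w m : G → ℝ}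
    (hm : IsModerate w m) {p : ℝ} (hp : 0 < p) {f : G → E} (hf : MemLpw β p w f) (x : G) :
    MemLpw β p m fun y => f (x⁻¹ * y) := by
  have hmeas : Measurable fun y : G => x⁻¹ * y := (continuous_const_mul x⁻¹).measurable
  have hemb : MeasurableEmbedding fun y : G => x⁻¹ * y :=
    (Homeomorph.mulLeft x⁻¹).measurableEmbedding
  have hmc : Measurable fun y => ENNReal.ofReal (m y ^ p) :=
    (hm.continuous.measurable.pow_const p).ennreal_ofReal
  have key : Measure.map (fun y : G => x⁻¹ * y) (weightedMeasure β p m) ≤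
      ENNReal.ofReal (m x ^ p) • weightedMeasure β p w := by
    refine Measure.le_iff.2 fun s hs => ?_
    rw [Measure.map_apply hmeas hs, Measure.smul_apply, smul_eq_mul, weightedMeasure,
      weightedMeasure, withDensity_apply _ (hmeas hs), withDensity_apply _ hs,
      ← lintegral_indicator (hmeas hs), ← lintegral_indicator hs,
      ← lintegral_const_mul' _ _ ENNReal.ofReal_ne_top, ← lintegral_mul_left_eq_self _ x]
    refine lintegral_mono fun z => ?_
    by_cases hz : z ∈ s
    · have h1 : x * z ∈ (fun y : G => x⁻¹ * y) ⁻¹' s := by simpa using hz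
      rw [indicator_of_mem h1, indicator_of_mem hz,
        ← ENNReal.ofReal_mul (Real.rpow_nonneg (hm.pos x).le p)]
      have hwz : 0 ≤ w z := by
        have h2 := hm.left z x
        have h3 := hm.pos x
        have h4 := hm.pos (z * x)
        by_contra hneg
        nlinarith [mul_neg_of_neg_of_pos (not_le.1 hneg) h3]
      rw [← Real.mul_rpow (hm.pos x).le hwz]
      exact ENNReal.ofReal_le_ofReal
        (Real.rpow_le_rpow (hm.pos _).le (hm.right x z) hp.le)
    · have h1 : x * z ∉ (fun y : G => x⁻¹ * y) ⁻¹' s := by simpa using hz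
      rw [indicator_of_notMem h1]
      exact zero_le
  exact hemb.memLp_map_measure_iff.1 (hf.of_measure_le_smul ENNReal.ofReal_ne_top key)

namespace Setting

variable (S : Setting β H)

/-- The voice transform `V v x = ⟨v, π x u⟩`. -/
def voice (v : H) (x : G) : ℂ := inner ℂ (S.π x S.u) v

/-- The reproducing kernel `K = V u`. -/
def K : G → ℂ := S.voice S.u

theorem w_moderate : IsModerate S.w S.w :=
  ⟨S.w_continuous, S.w_pos, S.w_mul, S.w_mul⟩

theorem one_le_w (x : G) : 1 ≤ S.w x := by
  have h1 : S.w 1 ≤ S.w 1 * S.w 1 := by simpa using S.w_mul 1 1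
  have h2 : S.w 1 ≤ S.w x * S.w x := by simpa [S.w_inv] using S.w_mul x x⁻¹
  have h3 := S.w_pos 1
  have h4 := S.w_pos x
  have h5 : 1 ≤ S.w 1 := by nlinarith
  nlinarith

theorem voice_π (x : G) (v : H) : S.voice (S.π x v) = fun y => S.voice v (x⁻¹ * y) := by
  funext y
  simp only [voice, map_mul]
  have h : S.π x ((S.π x⁻¹ * S.π y) S.u) = S.π y S.u := by
    change (S.π x * (S.π x⁻¹ * S.π y)) S.u = _
    rw [← map_mul, ← map_mul, mul_inv_cancel_left]
  rw [← LinearIsometryEquiv.inner_map_map (S.π x) ((S.π x⁻¹ * S.π y) S.u) v, h]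

/-- The test space `{v | V v ∈ L_{p,w} for all 1 < p < ∞}` as a subspace of `H`. -/
def testSubmodule : Submodule ℂ H where
  carrier := {v | ∀ p : ℝ, 1 < p → MemLpw β p S.w (S.voice v)}
  zero_mem' := fun p _ => by
    have : S.voice 0 = 0 := by funext x; simp [voice]
    rw [this]
    exact MemLp.zero
  add_mem' := fun {a b} ha hb p hp => by
    have : S.voice (a + b) = S.voice a + S.voice b := by
      funext x; simp [voice]
    rw [this]
    exact (ha p hp).add (hb p hp)
  smul_mem' := fun c a ha p hp => by
    have : S.voice (c • a) = c • S.voice a := by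
      funext x; simp [voice]
    rw [this]
    exact (ha p hp).const_smul c

/-- The test space `S_w`, with its own topology (not the one induced by `H`). -/
def TestSpace : Type _ := S.testSubmodule

instance : AddCommGroup S.TestSpace := inferInstanceAs (AddCommGroup S.testSubmodule)

instance : Module ℂ S.TestSpace := inferInstanceAs (Module ℂ S.testSubmodule)

/-- The inclusion of the test space into `H`. -/
def incl : S.TestSpace →ₗ[ℂ] H := S.testSubmodule.subtype

/-- The seminorms `‖v‖_p = ‖V v‖_{L_{p,w}}`, `1 < p < ∞`, of the test space. -/
def testSeminorm (p : {p : ℝ // 1 < p}) : Seminorm ℂ S.TestSpace :=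
  Seminorm.of (fun v => normLpw β p.1 S.w (S.voice (S.incl v)))
    (fun a b => by
      have ha : MemLpw β p.1 S.w (S.voice (S.incl a)) := a.2 p.1 p.2
      have hb : MemLpw β p.1 S.w (S.voice (S.incl b)) := b.2 p.1 p.2
      have : S.voice (S.incl (a + b)) = S.voice (S.incl a) + S.voice (S.incl b) := by
        funext x; simp [voice]
      simp only [normLpw, this]
      rw [← ENNReal.toReal_add ha.2.ne hb.2.ne]
      refine ENNReal.toReal_mono (ENNReal.add_ne_top.2 ⟨ha.2.ne, hb.2.ne⟩)
        (eLpNorm_add_le ha.1 hb.1 ?_)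
      simpa using ENNReal.ofReal_le_ofReal p.2.le)
    (fun c a => by
      have : S.voice (S.incl (c • a)) = c • S.voice (S.incl a) := by
        funext x; simp [voice]
      simp only [normLpw, this]
      rw [eLpNorm_const_smul, ENNReal.toReal_mul, toReal_enorm])

/-- The locally convex topology of the test space, generated by its seminorms. -/
instance : TopologicalSpace S.TestSpace :=
  (SeminormFamily.moduleFilterBasis (𝕜 := ℂ) (fun p => S.testSeminorm p)).topology

/-- The space of distributions: the continuous antilinear functionals on the test space. -/
abbrev TestDual : Type _ := S.TestSpace →SL[starRingEnd ℂ] ℂ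

theorem norm_incl_le (v : S.TestSpace) : ‖S.incl v‖ ≤ S.testSeminorm ⟨2, one_lt_two⟩ v := by
  have hv : MemLpw β 2 S.w (S.voice (S.incl v)) := v.2 2 one_lt_two
  have h1 : eLpNorm (S.voice (S.incl v)) 2 β = ‖S.incl v‖ₑ := S.isometry _
  have h2 : β ≤ weightedMeasure β 2 S.w := by
    calc β = β.withDensity 1 := withDensity_one.symm
      _ ≤ _ := withDensity_mono (Eventually.of_forall fun x => by
        simpa using ENNReal.ofReal_le_ofReal (Real.one_le_rpow (S.one_le_w x) zero_le_two))
  have h3 : ENNReal.ofReal (2 : ℝ) = 2 := by simp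
  change _ ≤ (eLpNorm (S.voice (S.incl v)) (ENNReal.ofReal 2) (weightedMeasure β 2 S.w)).toReal
  rw [← toReal_enorm, ← h1]
  refine ENNReal.toReal_mono hv.2.ne ?_
  rw [h3]
  exact eLpNorm_mono_measure _ h2

/-- The embedding of `H` into the distributions, `h ↦ (v ↦ ⟨h, v⟩)`. -/
def toDual (h : H) : S.TestDual where
  toFun v := inner ℂ (S.incl v) h
  map_add' a b := by simp
  map_smul' c a := by simp [mul_comm]
  cont := by
    let f : S.TestSpace →ₛₗ[starRingEnd ℂ] ℂ :=
      { toFun := fun v => inner ℂ (S.incl v) h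
        map_add' := fun a b => by simp
        map_smul' := fun c a => by simp [mul_comm] }
    have hw : WithSeminorms (𝕜 := ℂ) (fun p => S.testSeminorm p) := ⟨rfl⟩
    refine hw.continuous_normedSpace_rng ℂ f ⟨{⟨2, one_lt_two⟩}, ‖h‖₊, fun v => ?_⟩
    simp only [Finset.sup_singleton]
    change ‖inner ℂ (S.incl v) h‖ ≤ ‖h‖ * S.testSeminorm ⟨2, one_lt_two⟩ v
    refine (norm_inner_le_norm _ _).trans ?_
    rw [mul_comm]
    exact mul_le_mul_of_nonneg_left (S.norm_incl_le v) (norm_nonneg h)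

section Invariant

variable [β.IsMulLeftInvariant]

/-- The vector `π x u` as an element of the test space. -/
def testAtom (x : G) : S.TestSpace :=
  ⟨S.π x S.u, fun p hp => by
    rw [S.voice_π]
    exact memLpw_translate S.w_moderate (zero_lt_one.trans hp) (S.kernel_mem p hp) x⟩

/-- The vector `π x u` as a distribution. -/
def atom (x : G) : S.TestDual := S.toDual (S.π x S.u)

/-- The extended voice transform `V_e T x = ⟨T, π x u⟩`. -/
def extVoice (T : S.TestDual) (x : G) : ℂ := T (S.testAtom x)

/-- The coorbit space `Co(L_{r,m}) = {T | V_e T ∈ L_{r,m}}`. -/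
def Co (m : G → ℝ) (r : ℝ) : Submodule ℂ S.TestDual where
  carrier := {T | MemLpw β r m (S.extVoice T)}
  zero_mem' := MemLp.zero
  add_mem' := fun ha hb => MemLp.add ha hb
  smul_mem' := fun c _ ha => MemLp.const_smul ha c

/-- The norm `‖T‖ = ‖V_e T‖_{L_{r,m}}` of the coorbit space. -/
def coNorm (m : G → ℝ) (r : ℝ) (T : S.TestDual) : ℝ := normLpw β r m (S.extVoice T)

/-- The class in `L_{r,m}` of the left translate `λ(x) K : y ↦ K (x⁻¹ y)`. -/
def translateK {m : G → ℝ} (hm : IsModerate S.w m) (r : ℝ) [hr : Fact (1 < r)] (x : G) :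
    Lpw β r m :=
  (memLpw_translate hm (zero_lt_one.trans hr.out) (S.kernel_mem r hr.out) x).toLp

end Invariant

/-- The reproducing kernel space `{f ∈ L_{r,m} | f * K = f}`, with the convolution
`(f * K) x = ∫ f y K (y⁻¹ x) dy`. -/
def kernelSpace (m : G → ℝ) (r : ℝ) : Set (Lpw β r m) :=
  {f | (∀ᵐ x ∂β, Integrable (fun y => f y * S.K (y⁻¹ * x)) β) ∧
    ∀ᵐ x ∂β, ∫ y, f y * S.K (y⁻¹ * x) ∂β = f x}

end Setting

/-! ### Discretization -/

/-- The points `Y n`, `X n`, the neighbourhoods `Q n` of the identity, the splitting of `Y n` into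
`I` separated sets `Z n i`, and the partition of unity `ψ n x`, `x ∈ Y n`. -/
structure Discretization (β : Measure G) where
  Y : ℕ → Set G
  Y_countable : ∀ n, (Y n).Countable
  Y_mono : ∀ n, Y n ⊆ Y (n + 1)
  Y_dense : closure (⋃ n, Y n) = univ
  Q : ℕ → Set G
  Q_compact : ∀ n, IsCompact (Q n)
  Q_nhds : ∀ n, Q n ∈ 𝓝 (1 : G)
  cover : ∀ n, ⋃ x ∈ Y n, x • Q n = univ
  I : ℕ
  Z : ℕ → Fin I → Set G
  Y_eq : ∀ n, Y n = ⋃ i, Z n i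
  separated : ∀ n i, ∀ x ∈ Z n i, ∀ y ∈ Z n i, (x • Q n ∩ y • Q n).Nonempty ↔ x = y
  ψ : ℕ → G → G → ℝ
  ψ_measurable : ∀ n, ∀ x ∈ Y n, Measurable (ψ n x)
  ψ_nonneg : ∀ n, ∀ x ∈ Y n, ∀ y, 0 ≤ ψ n x y
  ψ_le_one : ∀ n, ∀ x ∈ Y n, ∀ y, ψ n x y ≤ 1
  ψ_sum : ∀ n y, HasSum (fun x : Y n => ψ n x y) 1
  ψ_support : ∀ n, ∀ x ∈ Y n, tsupport (ψ n x) ⊆ x • Q n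
  ψ_independent : ∀ (n : ℕ) (s : Finset G) (α : G → ℂ), (s : Set G) ⊆ Y n →
    (∀ᵐ y ∂β, ∑ x ∈ s, α x * (ψ n x y : ℂ) = 0) → ∀ x ∈ s, α x = 0
  X : ℕ → Finset G
  X_subset : ∀ n, (X n : Set G) ⊆ Y n
  X_mono : ∀ n, X n ⊆ X (n + 1)
  X_dense : closure (⋃ n, (X n : Set G)) = univ

theorem weight_ac (p : ℝ) {m : G → ℝ} (hc : Continuous m) (hpos : ∀ x, 0 < m x) :
    β ≪ weightedMeasure β p m :=
  withDensity_absolutelyContinuous'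
    (hc.measurable.pow_const p).ennreal_ofReal.aemeasurable
    (Eventually.of_forall fun x => by simpa using Real.rpow_pos_of_pos (hpos x) p)

/-- The pairing of `F ∈ L_{r,m}` with a bounded function supported in a compact set is defined. -/
theorem integrable_mul_ψ [IsFiniteMeasureOnCompacts β] [T2Space G] (D : Discretization β)
    {m : G → ℝ} (hc : Continuous m) (hpos : ∀ x, 0 < m x) (r : ℝ) [hr : Fact (1 < r)]
    (n : ℕ) {x : G} (hx : x ∈ D.Y n) (F : Lpw β r m) :
    Integrable (fun y => F y * (D.ψ n x y : ℂ)) β := by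
  set L : Set G := x • D.Q n with hL
  have hLc : IsCompact L := (D.Q_compact n).smul x
  have hsupp : ∀ y, y ∉ L → D.ψ n x y = 0 := fun y hy => by
    by_contra h
    exact hy (D.ψ_support n x hx (subset_tsupport _ h))
  have hFL : Integrable (fun y => F y) (β.restrict L) := by
    obtain ⟨c, hc0, hcL⟩ : ∃ c : ℝ, 0 < c ∧ ∀ y ∈ L, c ≤ m y := by
      rcases L.eq_empty_or_nonempty with h | h
      · exact ⟨1, one_pos, by simp [h]⟩
      · obtain ⟨z, _, hz'⟩ := hLc.exists_isMinOn h hc.continuousOn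
        exact ⟨m z, hpos z, fun y hy => hz' hy⟩
    have hcr : 0 < c ^ r := Real.rpow_pos_of_pos hc0 r
    have hle : β.restrict L ≤ ENNReal.ofReal ((c ^ r)⁻¹) • weightedMeasure β r m := by
      refine Measure.le_iff.2 fun s hs => ?_
      rw [Measure.restrict_apply hs, Measure.smul_apply, smul_eq_mul, weightedMeasure,
        withDensity_apply _ hs]
      have hsL : MeasurableSet (s ∩ L) := hs.inter hLc.isClosed.measurableSet
      have h1 : ENNReal.ofReal (c ^ r) * β (s ∩ L) ≤
          ∫⁻ y in s, ENNReal.ofReal (m y ^ r) ∂β := by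
        rw [← setLIntegral_const]
        refine (setLIntegral_mono' hsL fun y hy => ?_).trans
          (lintegral_mono_set inter_subset_left)
        exact ENNReal.ofReal_le_ofReal
          (Real.rpow_le_rpow hc0.le (hcL y hy.2) (zero_lt_one.trans hr.out).le)
      calc β (s ∩ L) = ENNReal.ofReal ((c ^ r)⁻¹) * (ENNReal.ofReal (c ^ r) * β (s ∩ L)) := by
            rw [← mul_assoc, ← ENNReal.ofReal_mul (inv_nonneg.2 hcr.le),
              inv_mul_cancel₀ hcr.ne']
            simp
        _ ≤ _ := by gcongr
    have : IsFiniteMeasure (β.restrict L) := ⟨by simpa using hLc.measure_lt_top⟩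
    exact ((Lp.memLp F).of_measure_le_smul ENNReal.ofReal_ne_top hle).integrable
      (Fact.out : (1 : ℝ≥0∞) ≤ ENNReal.ofReal r)
  have h2 : Integrable (fun y => F y * (D.ψ n x y : ℂ)) (β.restrict L) :=
    hFL.mul_bdd (c := 1)
      (Complex.measurable_ofReal.comp (D.ψ_measurable n x hx)).aestronglyMeasurable
      (Eventually.of_forall fun y => by
        rw [Complex.norm_real, Real.norm_of_nonneg (D.ψ_nonneg n x hx y)]
        exact D.ψ_le_one n x hx y)
  refine (integrableOn_iff_integrable_of_support_subset fun y hy => ?_).1 h2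
  by_contra h
  exact hy (by simp [hsupp y h])

namespace Setting

variable [T2Space G] [β.IsMulLeftInvariant] [IsFiniteMeasureOnCompacts β]
  (S : Setting β H) (D : Discretization β) {m : G → ℝ} (hm : IsModerate S.w m)
  (r : ℝ) [hr : Fact (1 < r)]

/-- The operator `T_n F = ∑_{x ∈ X n} ⟨F, ψ n x⟩ λ(x) K` on `L_{r,m}`. -/
def T (n : ℕ) : Lpw β r m →ₗ[ℂ] Lpw β r m where
  toFun F := ∑ x ∈ D.X n, (∫ y, F y * (D.ψ n x y : ℂ) ∂β) • S.translateK hm r x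
  map_add' F F' := by
    rw [← Finset.sum_add_distrib]
    refine Finset.sum_congr rfl fun x hx => ?_
    have hx' := D.X_subset n hx
    rw [← add_smul, ← integral_add
      (integrable_mul_ψ D hm.continuous hm.pos r n hx' F)
      (integrable_mul_ψ D hm.continuous hm.pos r n hx' F')]
    congr 1
    refine integral_congr_ae ?_
    filter_upwards [(weight_ac r hm.continuous hm.pos).ae_le (Lp.coeFn_add F F')] with y hy
    rw [hy, Pi.add_apply, add_mul]
  map_smul' c F := by
    rw [RingHom.id_apply, Finset.smul_sum]
    refine Finset.sum_congr rfl fun x _ => ?_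
    rw [← mul_smul, ← integral_const_mul]
    congr 1
    refine integral_congr_ae ?_
    filter_upwards [(weight_ac r hm.continuous hm.pos).ae_le (Lp.coeFn_smul c F)] with y hy
    rw [hy, Pi.smul_apply, smul_eq_mul, mul_assoc]

/-- The range `V_n` of `T_n`. -/
def V (n : ℕ) : Submodule ℂ (Lpw β r m) := LinearMap.range (S.T D hm r n)

instance (n : ℕ) : FiniteDimensional ℂ (S.V D hm r n) := by
  have hfin : ((fun x => S.translateK hm r x) '' (D.X n : Set G)).Finite :=
    (D.X n).finite_toSet.image _
  have := FiniteDimensional.span_of_finite ℂ hfin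
  refine Submodule.finiteDimensional_of_le
    (S₂ := Submodule.span ℂ ((fun x => S.translateK hm r x) '' (D.X n : Set G))) ?_
  rintro _ ⟨F, rfl⟩
  exact Submodule.sum_mem _ fun x hx =>
    Submodule.smul_mem _ _ (Submodule.subset_span ⟨x, hx, rfl⟩)

/-- The operator `T_n` as a map onto its range `V_n`. -/
def toV (n : ℕ) : Lpw β r m →ₗ[ℂ] S.V D hm r n := (S.T D hm r n).rangeRestrict

/-- The operator norm of a linear map `R : V_n → L_{r,m}` (bounded, as `V_n` is
finite-dimensional). -/
def opNorm {n : ℕ} (R : S.V D hm r n →ₗ[ℂ] Lpw β r m) : ℝ :=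
  ‖LinearMap.toContinuousLinearMap R‖

/-- The constant `C_n = |Q_n| ^ (1 / r') * sup_{Q_n} w * ‖R‖`, where `1 / r + 1 / r' = 1`. -/
def constC {n : ℕ} (R : S.V D hm r n →ₗ[ℂ] Lpw β r m) : ℝ :=
  β.real (D.Q n) ^ (1 - 1 / r) * (⨆ q : D.Q n, S.w q) * S.opNorm D hm r R

end Setting

section ConstD

variable [LocallyCompactSpace G] (S : Setting β H) (D : Discretization β)

/-- The weight `w Δ ^ (-1 / p)`. -/
def Setting.twistedWeight (p : ℝ) (x : G) : ℝ := S.w x * modularFunction x ^ (-(1 / p))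

/-- The constant `θ_n`: the larger of the norms of `osc_{Q_n} K + |K|` in `L_{p,w}` and in
`L_{p, w Δ ^ (-1 / p)}`. -/
def Setting.constTheta (p : ℝ) (n : ℕ) : ℝ :=
  max (normLpw β p S.w fun x => osc (D.Q n) S.K x + ‖S.K x‖)
    (normLpw β p (S.twistedWeight p) fun x => osc (D.Q n) S.K x + ‖S.K x‖)

/-- The constant `D_n = |Q_n| ^ (1 / q - 1) * I ^ (1 - 1 / q) * sup_{Q_n} w * θ_n`. -/
def Setting.constD (p q : ℝ) (n : ℕ) : ℝ :=
  β.real (D.Q n) ^ (1 / q - 1) * (D.I : ℝ) ^ (1 - 1 / q) * (⨆ y : D.Q n, S.w y) *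
    S.constTheta D p n

end ConstD

/-- The family `d` lies in `ℓ_{q,m}`. -/
def MemSeq (m : G → ℝ) (q : ℝ) {s : Set G} (d : s → ℂ) : Prop :=
  Summable fun x : s => (‖d x‖ * m x) ^ q

/-- The norm of `d` in `ℓ_{q,m}`. -/
def seqNorm (m : G → ℝ) (q : ℝ) {s : Set G} (d : s → ℂ) : ℝ :=
  (∑' x : s, (‖d x‖ * m x) ^ q) ^ (1 / q)

end Theory

end Coorbit

end

/-! Both parts are read off from voice transforms, where `atom x` becomes the translate `λ(x)K`.

Part (i). The transform `f = V_e T` satisfies `f * K = f` (`extVoice_eq_integral`), so by the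
density hypothesis it is a limit of combinations of translates of `K`. Since `x ↦ λ(x)K` is
continuous into `L_{r,m}` and the `X_n` increase to a dense set, `f` lies in the closure of `⋃ V_n`;
here independence of the `ψ` is what makes `V_n` the full span of the `λ(x)K`, `x ∈ X_n`. Take `g_n
∈ V_n` tending to `f`, put `F_n = R_n g_n`, and let the coefficients be `∫ F_n ψ_x`. Then `T_n F_n =
g_n`, and Hölder's inequality with `∑ ψ_x ≤ 1` bounds the coefficients (`coefficients_le`).

The reproducing formula for a distribution needs an argument, since `T` acts only on test vectors.
`T` is bounded by finitely many seminorms, so Hahn–Banach extends its conjugate to the Banach space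
`H × ∏ L_{p,w}`. There the Bochner integrals of `K(x⁻¹y) π(y)u` over compact sets converge to
`π(x)u`, by dominated convergence with `|K| * |K| ∈ L_{p,w}` (`tendsto_ambient_integral`).

Part (ii). For `x ∈ yQ` the value `|K(y⁻¹z)|` is at most `osc K + |K|` at `x⁻¹z`. Averaging over
`yQ` bounds `∑ |d_y| |K(y⁻¹z)|` by the convolution of a step function with `osc K + |K|`, divided by
`|Q|`, and Young's inequality applies (`weightedNorm_absSum_le`). Without unimodularity it also
needs the norm of the reflected factor, which is the norm with weight `w Δ^(-1/p)`. The bound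
applied to tails of `d` gives norm convergence, and a Hölder pairing with `V v = V v * K` gives
pointwise convergence. -/

namespace Coorbit

/-! ### Right translation and inversion of Haar measure -/

section Group

variable {G : Type*} [Group G] [TopologicalSpace G] [IsTopologicalGroup G]
  [LocallyCompactSpace G] [SecondCountableTopology G] [MeasurableSpace G] [BorelSpace G]
  (β : Measure G) [β.IsHaarMeasure]

theorem lintegral_mul_right (f : G → ℝ≥0∞) (hf : Measurable f) (g : G) :
    ∫⁻ x, f (x * g) ∂β = Measure.modularCharacterFun g * ∫⁻ x, f x ∂β := by
  rw [← lintegral_map hf (measurable_mul_const g),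
    Measure.isMulLeftInvariant_eq_smul (Measure.map (· * g) β) β,
    ← Measure.modularCharacterFun_eq_haarScalarFactor, lintegral_smul_measure]
  rfl

/-- Right translation of one fixed compact neighbourhood exhibits the modular character as a
parameter integral, measurable by Tonelli. -/
theorem measurable_modularCharacterFun :
    Measurable fun g : G => (Measure.modularCharacterFun g : ℝ≥0∞) := by
  obtain ⟨s, hs, h1⟩ := exists_compact_mem_nhds (1 : G)
  set β : Measure G := Measure.haar
  have hm : MeasurableSet (closure s) := isClosed_closure.measurableSet
  have h0 : β (closure s) ≠ 0 := (Measure.measure_pos_of_mem_nhds β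
    (mem_of_superset h1 subset_closure)).ne'
  have ht : β (closure s) ≠ ∞ := hs.closure.measure_lt_top.ne
  have h : (fun g : G => (Measure.modularCharacterFun g : ℝ≥0∞)) = fun g =>
      (∫⁻ x, (closure s).indicator 1 (x * g) ∂β) / β (closure s) := by
    funext g
    rw [lintegral_mul_right β _ (measurable_one.indicator hm), lintegral_indicator_one hm,
      ENNReal.mul_div_cancel_right h0 ht]
  rw [h]
  refine Measurable.div_const ?_ _
  exact Measurable.lintegral_prod_left' (f := fun z : G × G => (closure s).indicator 1 (z.1 * z.2))
    ((measurable_one.indicator hm).comp measurable_mul)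

theorem modularCharacterFun_inv_mul (x : G) :
    (Measure.modularCharacterFun x⁻¹ : ℝ≥0∞) * Measure.modularCharacterFun x = 1 := by
  rw [← ENNReal.coe_mul, ← Measure.modularCharacterFun_map_mul, inv_mul_cancel,
    Measure.modularCharacterFun_map_one, ENNReal.coe_one]

/-- The inversion formula for a left Haar measure. -/
theorem lintegral_inv (f : G → ℝ≥0∞) (hf : Measurable f) :
    ∫⁻ x, f x⁻¹ ∂β = ∫⁻ x, Measure.modularCharacterFun x * f x ∂β := by
  obtain ⟨s, hs, h1⟩ := exists_compact_mem_nhds (1 : G)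
  have hm : MeasurableSet (closure s) := isClosed_closure.measurableSet
  have h0 : β (closure s) ≠ 0 := (Measure.measure_pos_of_mem_nhds β
    (mem_of_superset h1 subset_closure)).ne'
  have ht : β (closure s) ≠ ∞ := hs.closure.measure_lt_top.ne
  set b : G → ℝ≥0∞ := fun x => Measure.modularCharacterFun x * f x with hb
  have hbm : Measurable b := measurable_modularCharacterFun.mul hf
  -- The substitution `(x, y) ↦ (yx, x⁻¹)` preserves `β × β`. Applied to `1_s ⊗ b`, the right
  -- translation of `1_s` by `x` produces the modular factor that cancels the one in `b x⁻¹`, and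
  -- the measure of `s` then divides out.
  have key := lintegral_lintegral_mul_inv β β
    (fun x y => (closure s).indicator 1 x * b y)
    (((measurable_one.indicator hm).comp measurable_fst).mul
      (hbm.comp measurable_snd)).aemeasurable
  have e1 : ∀ x, ∫⁻ y, (closure s).indicator 1 (y * x) * b x⁻¹ ∂β =
      β (closure s) * f x⁻¹ := fun x => by
    have hmx : Measurable fun y => (closure s).indicator (1 : G → ℝ≥0∞) (y * x) :=
      (measurable_one.indicator hm).comp (measurable_mul_const x)
    rw [lintegral_mul_const _ hmx,
      lintegral_mul_right β _ (measurable_one.indicator hm), lintegral_indicator_one hm, hb]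
    dsimp only
    calc _ = β (closure s) * f x⁻¹ * ((Measure.modularCharacterFun x⁻¹ : ℝ≥0∞) *
          Measure.modularCharacterFun x) := by ring
      _ = _ := by rw [modularCharacterFun_inv_mul, mul_one]
  simp only [e1] at key
  have hfi : Measurable fun x => f x⁻¹ := hf.comp measurable_inv
  rw [lintegral_const_mul _ hfi] at key
  have e2 : ∀ x, ∫⁻ y, (closure s).indicator 1 x * b y ∂β =
      (closure s).indicator 1 x * ∫⁻ y, b y ∂β := fun x => lintegral_const_mul _ hbm
  simp only [e2] at key
  rw [lintegral_mul_const _ (measurable_one.indicator hm), lintegral_indicator_one hm] at key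
  exact (ENNReal.mul_right_inj h0 ht).1 key

theorem lintegral_inv_mul_eq (f : G → ℝ≥0∞) (x : G) :
    ∫⁻ y, f (y⁻¹ * x) ∂β = ∫⁻ y, f y⁻¹ ∂β := by
  rw [← lintegral_mul_left_eq_self _ x]
  simp

end Group

/-! ### Young's inequality without unimodularity -/

section Young

variable {G : Type*} [Group G] [TopologicalSpace G] [IsTopologicalGroup G]
  [LocallyCompactSpace G] [SecondCountableTopology G] [MeasurableSpace G] [BorelSpace G]
  (β : Measure G) [β.IsHaarMeasure]

/-- Young's inequality on a group that need not be unimodular. -/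
theorem young {p q r : ℝ} (hp : 1 ≤ p) (hq : 1 ≤ q) (hr : 0 < r) (h : 1 / q + 1 / p = 1 + 1 / r)
    (f g : G → ℝ≥0∞) (hf : Measurable f) (hg : Measurable g) :
    (∫⁻ x, (∫⁻ y, f y * g (y⁻¹ * x) ∂β) ^ r ∂β) ^ (1 / r) ≤
      (∫⁻ x, f x ^ q ∂β) ^ (1 / q) *
        max ((∫⁻ x, g x ^ p ∂β) ^ (1 / p)) ((∫⁻ x, g x⁻¹ ^ p ∂β) ^ (1 / p)) := by
  have hp0 : 0 < p := by linarith
  have hq0 : 0 < q := by linarith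
  have ha : 0 ≤ 1 - 1 / p := by rw [sub_nonneg, div_le_one hp0]; exact hp
  have hb : 0 ≤ 1 - 1 / q := by rw [sub_nonneg, div_le_one hq0]; exact hq
  have hc : 0 ≤ 1 / r := by positivity
  set A := ∫⁻ x, f x ^ q ∂β with hA
  set B := ∫⁻ x, g x ^ p ∂β with hB
  set B' := ∫⁻ x, g x⁻¹ ^ p ∂β with hB'
  have hmul : ∀ x : G, Measurable fun y : G => y⁻¹ * x := fun x =>
    measurable_inv.mul_const x
  have hfq : Measurable fun x => f x ^ q := hf.pow_const q
  have hgp : Measurable fun x => g x ^ p := hg.pow_const p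
  -- Hölder for `f g = (f^q g^p)^(1/r) (f^q)^(1-1/p) (g^p)^(1-1/q)`, whose exponents add up to one.
  -- The last factor is integrated in `y`, which enters inverted; this is the source of `B'`.
  have hpt : ∀ x, ∫⁻ y, f y * g (y⁻¹ * x) ∂β ≤
      (∫⁻ y, f y ^ q * g (y⁻¹ * x) ^ p ∂β) ^ (1 / r) * (A ^ (1 - 1 / p) * B' ^ (1 - 1 / q)) := by
    intro x
    have hgx : Measurable fun y => g (y⁻¹ * x) ^ p := hgp.comp (hmul x)
    have := ENNReal.lintegral_prod_norm_pow_le (μ := β) (Finset.univ : Finset (Fin 3))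
      (f := ![fun y => f y ^ q * g (y⁻¹ * x) ^ p, fun y => f y ^ q, fun y => g (y⁻¹ * x) ^ p])
      (p := ![1 / r, 1 - 1 / p, 1 - 1 / q])
      (by
        intro i _
        fin_cases i
        · exact (hfq.mul hgx).aemeasurable
        · exact hfq.aemeasurable
        · exact hgx.aemeasurable)
      (by simp [Fin.sum_univ_three]; simp at h; linarith)
      (by
        intro i _
        fin_cases i
        · exact hc
        · exact ha
        · exact hb)
    simp only [Fin.prod_univ_three, Matrix.cons_val_zero, Matrix.cons_val_one,
      Matrix.cons_val] at this
    rw [lintegral_inv_mul_eq β fun x => g x ^ p] at this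
    rw [← mul_assoc]
    refine le_trans (le_of_eq (lintegral_congr fun y => ?_)) this
    rw [ENNReal.mul_rpow_of_nonneg _ _ hc, ← ENNReal.rpow_mul, ← ENNReal.rpow_mul,
      ← ENNReal.rpow_mul, ← ENNReal.rpow_mul]
    calc f y * g (y⁻¹ * x) = f y ^ (q * (1 / r) + q * (1 - 1 / p)) *
          g (y⁻¹ * x) ^ (p * (1 / r) + p * (1 - 1 / q)) := by
          have e1 : q * (1 / r) + q * (1 - 1 / p) = 1 := by
            have : 1 / r + (1 - 1 / p) = 1 / q := by linarith
            rw [← mul_add, this]; field_simp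
          have e2 : p * (1 / r) + p * (1 - 1 / q) = 1 := by
            have : 1 / r + (1 - 1 / q) = 1 / p := by linarith
            rw [← mul_add, this]; field_simp
          rw [e1, e2, ENNReal.rpow_one, ENNReal.rpow_one]
      _ = _ := by
          rw [ENNReal.rpow_add_of_nonneg _ _ (by positivity) (by positivity),
            ENNReal.rpow_add_of_nonneg _ _ (by positivity) (by positivity)]
          ring
  have hfub : ∫⁻ x, ∫⁻ y, f y ^ q * g (y⁻¹ * x) ^ p ∂β ∂β = A * B := by
    rw [lintegral_lintegral_swap]
    · have : ∀ y, ∫⁻ x, f y ^ q * g (y⁻¹ * x) ^ p ∂β = f y ^ q * B := fun y => by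
        have hgy : Measurable fun x => g (y⁻¹ * x) ^ p := hgp.comp (measurable_const_mul y⁻¹)
        rw [lintegral_const_mul _ hgy,
          lintegral_mul_left_eq_self (fun x => g x ^ p) y⁻¹]
      simp only [this]
      rw [lintegral_mul_const _ hfq]
    · exact ((hfq.comp measurable_snd).mul
        (hgp.comp (measurable_snd.inv.mul measurable_fst))).aemeasurable
  have hmeas : Measurable fun x => ∫⁻ y, f y ^ q * g (y⁻¹ * x) ^ p ∂β :=
    Measurable.lintegral_prod_right' (f := fun z : G × G => f z.2 ^ q * g (z.2⁻¹ * z.1) ^ p)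
      ((hfq.comp measurable_snd).mul (hgp.comp (measurable_snd.inv.mul measurable_fst)))
  have hint : ∫⁻ x, (∫⁻ y, f y * g (y⁻¹ * x) ∂β) ^ r ∂β ≤
      A * B * (A ^ (1 - 1 / p) * B' ^ (1 - 1 / q)) ^ r := by
    rw [← hfub, ← lintegral_mul_const _ hmeas]
    refine lintegral_mono fun x => ?_
    refine (ENNReal.rpow_le_rpow (hpt x) hr.le).trans (le_of_eq ?_)
    rw [ENNReal.mul_rpow_of_nonneg _ _ hr.le, ← ENNReal.rpow_mul, one_div_mul_cancel hr.ne',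
      ENNReal.rpow_one]
  calc _ ≤ (A * B * (A ^ (1 - 1 / p) * B' ^ (1 - 1 / q)) ^ r) ^ (1 / r) :=
        ENNReal.rpow_le_rpow hint hc
    _ = A ^ (1 / r + (1 - 1 / p)) * (B ^ (1 / r) * B' ^ (1 - 1 / q)) := by
        rw [ENNReal.mul_rpow_of_nonneg _ _ hc, ← ENNReal.rpow_mul, mul_one_div_cancel hr.ne',
          ENNReal.rpow_one, ENNReal.mul_rpow_of_nonneg _ _ hc,
          ENNReal.rpow_add_of_nonneg _ _ hc ha]
        ring
    _ ≤ _ := by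
        have e1 : 1 / r + (1 - 1 / p) = 1 / q := by linarith
        rw [e1]
        gcongr
        -- The exponents of `B` and `B'` add up to `1/p`, so this geometric mean is at most the
        -- maximum.
        set M := max (B ^ (1 / p)) (B' ^ (1 / p)) with hM
        have hB1 : B = (B ^ (1 / p)) ^ p := by
          rw [← ENNReal.rpow_mul, one_div_mul_cancel hp0.ne', ENNReal.rpow_one]
        have hB2 : B' = (B' ^ (1 / p)) ^ p := by
          rw [← ENNReal.rpow_mul, one_div_mul_cancel hp0.ne', ENNReal.rpow_one]
        calc B ^ (1 / r) * B' ^ (1 - 1 / q) ≤ (M ^ p) ^ (1 / r) * (M ^ p) ^ (1 - 1 / q) := by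
              gcongr
              · rw [hB1]; exact ENNReal.rpow_le_rpow (le_max_left _ _) hp0.le
              · rw [hB2]; exact ENNReal.rpow_le_rpow (le_max_right _ _) hp0.le
          _ = M := by
              rw [← ENNReal.rpow_add_of_nonneg _ _ hc hb, ← ENNReal.rpow_mul]
              have : 1 / r + (1 - 1 / q) = 1 / p := by linarith
              rw [this, mul_one_div_cancel hp0.ne', ENNReal.rpow_one]

end Young

end Coorbit

namespace Coorbit

/-! ### Weighted norms with values in `[0, ∞]` -/

section WeightedNorm

variable {G : Type*} [MeasurableSpace G] (β : Measure G)

/-- The weighted norm `(∫ (w f) ^ p) ^ (1 / p)` of a function with values in `[0, ∞]`. -/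
noncomputable def weightedNorm (p : ℝ) (w : G → ℝ) (f : G → ℝ≥0∞) : ℝ≥0∞ :=
  (∫⁻ x, (ENNReal.ofReal (w x) * f x) ^ p ∂β) ^ (1 / p)

variable {β} {E : Type*} [NormedAddCommGroup E] {p : ℝ} {w : G → ℝ}

theorem eLpNorm_weightedMeasure (hp : 0 < p) (hw : Measurable w) (hw0 : ∀ x, 0 ≤ w x)
    (f : G → E) :
    eLpNorm f (ENNReal.ofReal p) (weightedMeasure β p w) =
      weightedNorm β p w fun x => ‖f x‖ₑ := by
  rw [eLpNorm_eq_lintegral_rpow_enorm_toReal (by simpa using hp) ENNReal.ofReal_ne_top,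
    ENNReal.toReal_ofReal hp.le, weightedMeasure,
    lintegral_withDensity_eq_lintegral_mul_non_measurable _ (hw.pow_const p).ennreal_ofReal
      (Eventually.of_forall fun x => ENNReal.ofReal_lt_top), weightedNorm]
  congr 1
  refine lintegral_congr fun x => ?_
  rw [Pi.mul_apply, ENNReal.mul_rpow_of_nonneg _ _ hp.le,
    ENNReal.ofReal_rpow_of_nonneg (hw0 x) hp.le]

theorem normLpw_eq (hp : 0 < p) (hw : Measurable w) (hw0 : ∀ x, 0 ≤ w x) (f : G → E) :
    normLpw β p w f = (weightedNorm β p w fun x => ‖f x‖ₑ).toReal := by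
  rw [normLpw, eLpNorm_weightedMeasure hp hw hw0]

theorem weightedMeasure_ac : weightedMeasure β p w ≪ β :=
  withDensity_absolutelyContinuous _ _

theorem ac_weightedMeasure (hw : Measurable w) (hw0 : ∀ x, 0 < w x) :
    β ≪ weightedMeasure β p w :=
  withDensity_absolutelyContinuous' (hw.pow_const p).ennreal_ofReal.aemeasurable
    (Eventually.of_forall fun x => by simpa using Real.rpow_pos_of_pos (hw0 x) p)

theorem memLpw_iff (hp : 0 < p) (hw : Measurable w) (hw0 : ∀ x, 0 < w x) {f : G → E} :
    MemLpw β p w f ↔ AEStronglyMeasurable f β ∧ weightedNorm β p w (fun x => ‖f x‖ₑ) < ∞ := by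
  rw [MemLpw, MemLp, eLpNorm_weightedMeasure hp hw fun x => (hw0 x).le]
  exact and_congr_left' ⟨fun h => h.mono_ac (ac_weightedMeasure hw hw0),
    fun h => h.mono_ac weightedMeasure_ac⟩

theorem weightedNorm_mono (hp : 0 < p) {f g : G → ℝ≥0∞} (h : ∀ᵐ x ∂β, f x ≤ g x) :
    weightedNorm β p w f ≤ weightedNorm β p w g := by
  refine ENNReal.rpow_le_rpow (lintegral_mono_ae ?_) (by positivity)
  filter_upwards [h] with x hx
  gcongr

theorem weightedNorm_const_mul (hp : 0 < p) {c : ℝ≥0∞} (hc : c ≠ ∞) (f : G → ℝ≥0∞) :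
    weightedNorm β p w (fun x => c * f x) = c * weightedNorm β p w f := by
  have : ∀ x, (ENNReal.ofReal (w x) * (c * f x)) ^ p =
      c ^ p * (ENNReal.ofReal (w x) * f x) ^ p := fun x => by
    rw [← ENNReal.mul_rpow_of_nonneg _ _ hp.le]
    ring_nf
  simp only [weightedNorm, this]
  rw [lintegral_const_mul' _ _ (ENNReal.rpow_ne_top_of_nonneg hp.le hc),
    ENNReal.mul_rpow_of_nonneg _ _ (by positivity), ← ENNReal.rpow_mul,
    mul_one_div_cancel hp.ne', ENNReal.rpow_one]

theorem weightedNorm_rpow (hp : 0 < p) (f : G → ℝ≥0∞) :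
    weightedNorm β p w f ^ p = ∫⁻ x, (ENNReal.ofReal (w x) * f x) ^ p ∂β := by
  rw [weightedNorm, ← ENNReal.rpow_mul, one_div_mul_cancel hp.ne', ENNReal.rpow_one]

/-- Hölder's inequality for a pair of weights whose product is bounded from below. -/
theorem lintegral_mul_le_weightedNorm {r r' : ℝ} (hr : r.HolderConjugate r') {m : G → ℝ}
    (hw : Measurable w) (hm : Measurable m) {c : ℝ} (hc : 0 < c) (hcw : ∀ x, c ≤ w x * m x)
    (hm0 : ∀ x, 0 ≤ m x) {f g : G → ℝ≥0∞} (hf : AEMeasurable f β) (hg : AEMeasurable g β) :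
    ∫⁻ x, f x * g x ∂β ≤
      ENNReal.ofReal c⁻¹ * (weightedNorm β r' w f * weightedNorm β r m g) := by
  have hwf : AEMeasurable (fun x => ENNReal.ofReal (w x) * f x) β :=
    hw.ennreal_ofReal.aemeasurable.mul hf
  have hmg : AEMeasurable (fun x => ENNReal.ofReal (m x) * g x) β :=
    hm.ennreal_ofReal.aemeasurable.mul hg
  refine le_trans ?_ (mul_le_mul_right
    (ENNReal.lintegral_mul_le_Lp_mul_Lq β hr.symm hwf hmg) _)
  rw [← lintegral_const_mul' _ _ ENNReal.ofReal_ne_top]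
  refine lintegral_mono fun x => ?_
  have h1 : 1 ≤ ENNReal.ofReal c⁻¹ * (ENNReal.ofReal (w x) * ENNReal.ofReal (m x)) := by
    rw [← ENNReal.ofReal_mul' (hm0 x), ← ENNReal.ofReal_mul (inv_nonneg.2 hc.le),
      ← ENNReal.ofReal_one]
    refine ENNReal.ofReal_le_ofReal ?_
    rw [← inv_mul_cancel₀ hc.ne']
    exact mul_le_mul_of_nonneg_left (hcw x) (inv_nonneg.2 hc.le)
  calc f x * g x = 1 * (f x * g x) := (one_mul _).symm
    _ ≤ ENNReal.ofReal c⁻¹ * (ENNReal.ofReal (w x) * ENNReal.ofReal (m x)) * (f x * g x) := by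
        gcongr
    _ = _ := by simp only [Pi.mul_apply]; ring

end WeightedNorm

/-! ### Weighted Young inequality and the twisted weight -/

section WeightedYoung

variable {G : Type*} [Group G] [TopologicalSpace G] [IsTopologicalGroup G]
  [LocallyCompactSpace G] [SecondCountableTopology G] [MeasurableSpace G] [BorelSpace G]
  {β : Measure G} [β.IsHaarMeasure]

/-- Since `m x ≤ m y * w (y⁻¹ x)`, the weight splits over the two factors, and the unweighted
inequality for `m f` and `w g` suffices. -/
theorem weightedNorm_convolution_le {p q r : ℝ} (hp : 1 ≤ p) (hq : 1 ≤ q) (hr : 0 < r)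
    (h : 1 / q + 1 / p = 1 + 1 / r) {w m : G → ℝ} (hw : Measurable w) (hm : Measurable m)
    (hm0 : ∀ x, 0 ≤ m x) (hmw : ∀ x y, m (x * y) ≤ m x * w y)
    {f g : G → ℝ≥0∞} (hf : Measurable f) (hg : Measurable g) :
    weightedNorm β r m (fun x => ∫⁻ y, f y * g (y⁻¹ * x) ∂β) ≤
      weightedNorm β q m f * max (weightedNorm β p w g)
        ((∫⁻ x, (ENNReal.ofReal (w x⁻¹) * g x⁻¹) ^ p ∂β) ^ (1 / p)) := by
  refine le_trans ?_ (young β hp hq hr h (fun x => ENNReal.ofReal (m x) * f x)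
    (fun x => ENNReal.ofReal (w x) * g x) (hm.ennreal_ofReal.mul hf) (hw.ennreal_ofReal.mul hg))
  refine ENNReal.rpow_le_rpow (lintegral_mono fun x => ENNReal.rpow_le_rpow ?_ hr.le)
    (by positivity)
  rw [← lintegral_const_mul' _ _ ENNReal.ofReal_ne_top]
  refine lintegral_mono fun y => ?_
  calc ENNReal.ofReal (m x) * (f y * g (y⁻¹ * x))
      ≤ ENNReal.ofReal (m y * w (y⁻¹ * x)) * (f y * g (y⁻¹ * x)) := by
        gcongr
        simpa using hmw y (y⁻¹ * x)
    _ = _ := by rw [ENNReal.ofReal_mul (hm0 y)]; ring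

/-- Inversion introduces the density `Δ⁻¹`; moved inside the `p`-th power it becomes `Δ^(-1/p)`.
This is why the twisted weight occurs. -/
theorem lintegral_inv_eq_weightedNorm_twisted {H : Type*} [NormedAddCommGroup H]
    [InnerProductSpace ℂ H] (S : Setting β H) {p : ℝ} (hp : 0 < p) {g : G → ℝ≥0∞}
    (hg : Measurable g) :
    (∫⁻ x, (ENNReal.ofReal (S.w x⁻¹) * g x⁻¹) ^ p ∂β) ^ (1 / p) =
      weightedNorm β p (S.twistedWeight p) g := by
  rw [lintegral_inv β (fun x => (ENNReal.ofReal (S.w x) * g x) ^ p)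
    ((S.w_continuous.measurable.ennreal_ofReal.mul hg).pow_const p), weightedNorm]
  congr 1
  refine lintegral_congr fun x => ?_
  rw [Setting.twistedWeight, modularFunction, ENNReal.ofReal_mul (S.w_pos x).le,
    Real.rpow_neg (by positivity), Real.inv_rpow (by positivity), inv_inv,
    ← ENNReal.ofReal_rpow_of_nonneg (by positivity) (by positivity), ENNReal.ofReal_coe_nnreal,
    mul_right_comm, ENNReal.mul_rpow_of_nonneg (_ * _) (_ ^ _) hp.le, ← ENNReal.rpow_mul,
    one_div_mul_cancel hp.ne', ENNReal.rpow_one, mul_comm]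

theorem measurable_modularFunction : Measurable (modularFunction : G → ℝ) := by
  have h : (modularFunction : G → ℝ) =
      fun x => ((Measure.modularCharacterFun x : ℝ≥0∞).toReal)⁻¹ := rfl
  rw [h]
  exact measurable_modularCharacterFun.ennreal_toReal.inv

theorem Setting.measurable_twistedWeight {H : Type*} [NormedAddCommGroup H]
    [InnerProductSpace ℂ H] (S : Setting β H) (p : ℝ) : Measurable (S.twistedWeight p) :=
  S.w_continuous.measurable.mul (measurable_modularFunction.pow_const _)

theorem Setting.twistedWeight_pos {H : Type*} [NormedAddCommGroup H]
    [InnerProductSpace ℂ H] (S : Setting β H) (p : ℝ) (x : G) : 0 < S.twistedWeight p x :=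
  mul_pos (S.w_pos x) (Real.rpow_pos_of_pos
    (inv_pos.2 (by exact_mod_cast Measure.modularCharacterFun_pos x)) _)

end WeightedYoung

/-! ### The kernel and the reproducing formula on `H` -/

section Kernel

variable {G : Type*} [Group G] [TopologicalSpace G] [IsTopologicalGroup G]
  [LocallyCompactSpace G] [SecondCountableTopology G] [MeasurableSpace G] [BorelSpace G]
  {β : Measure G} [β.IsHaarMeasure] {H : Type*} [NormedAddCommGroup H] [InnerProductSpace ℂ H]

namespace IsModerate

/-- A moderate weight is at least a multiple of `1 / w`. -/
theorem one_le_mul (S : Setting β H) {m : G → ℝ} (hm : IsModerate S.w m) (x : G) :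
    m 1 ≤ S.w x * m x := by
  simpa [S.w_inv] using hm.left x⁻¹ x

end IsModerate

namespace Setting

variable (S : Setting β H)

theorem continuous_voice (v : H) : Continuous (S.voice v) :=
  (S.π_continuous S.u).inner continuous_const

theorem continuous_K : Continuous S.K := S.continuous_voice S.u

theorem K_inv_mul (x y : G) : S.K (y⁻¹ * x) = inner ℂ (S.π x S.u) (S.π y S.u) :=
  (congrFun (S.voice_π y S.u) x).symm

theorem voice_π_u (x y : G) : S.voice (S.π x S.u) y = S.K (x⁻¹ * y) :=
  congrFun (S.voice_π x S.u) y

theorem K_inv (x : G) : S.K x⁻¹ = starRingEnd ℂ (S.K x) := by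
  have h1 := S.K_inv_mul 1 x
  have h2 := S.K_inv_mul x 1
  simp only [mul_one, inv_one, one_mul] at h1 h2
  rw [h1, h2, inner_conj_symm]

theorem enorm_K_inv (x : G) : ‖S.K x⁻¹‖ₑ = ‖S.K x‖ₑ := by
  rw [S.K_inv, ← ofReal_norm, ← ofReal_norm, RCLike.norm_conj]

theorem norm_K_le (x : G) : ‖S.K x‖ ≤ ‖S.u‖ * ‖S.u‖ := by
  have := norm_inner_le_norm (𝕜 := ℂ) (S.π x S.u) S.u
  rwa [LinearIsometryEquiv.norm_map] at this

theorem memLp_voice (v : H) : MemLp (S.voice v) 2 β :=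
  ⟨(S.continuous_voice v).aestronglyMeasurable, by
    change eLpNorm (fun x => inner ℂ (S.π x S.u) v) 2 β < ∞
    rw [S.isometry]
    exact enorm_lt_top⟩

/-- The voice transform as an isometry into `L_2`. -/
noncomputable def voiceL2 : H →ₗᵢ[ℂ] Lp ℂ 2 β where
  toFun v := (S.memLp_voice v).toLp
  map_add' a b := by
    rw [← MemLp.toLp_add]
    exact MemLp.toLp_congr _ _ (Eventually.of_forall fun x => by simp [voice])
  map_smul' c a := by
    rw [RingHom.id_apply, ← MemLp.toLp_const_smul]
    exact MemLp.toLp_congr _ _ (Eventually.of_forall fun x => by simp [voice])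
  norm_map' v := by
    change ‖(S.memLp_voice v).toLp‖ = ‖v‖
    rw [Lp.norm_toLp]
    change (eLpNorm (fun x => inner ℂ (S.π x S.u) v) 2 β).toReal = _
    rw [S.isometry, toReal_enorm]

/-- By the Hermitian symmetry of `K` the integrand is `V v` times the conjugate of `V (π x u)`, a
product of two `L_2` functions. -/
theorem integrable_voice_mul_K (v : H) (x : G) :
    Integrable (fun z => S.voice v z * S.K (z⁻¹ * x)) β := by
  have h : (fun z => S.voice v z * S.K (z⁻¹ * x)) =
      fun z => S.voice v z * starRingEnd ℂ (S.voice (S.π x S.u) z) := by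
    funext z
    rw [S.voice_π_u, ← S.K_inv, mul_inv_rev, inv_inv]
  rw [h]
  exact MemLp.integrable_mul (S.memLp_voice v) (S.memLp_voice (S.π x S.u)).star

/-- The reproducing formula `V v * K = V v` on `H`. -/
theorem voice_eq_integral (v : H) (x : G) :
    S.voice v x = ∫ z, S.voice v z * S.K (z⁻¹ * x) ∂β := by
  -- An isometry preserves inner products, and the inner product of the transforms in `L_2` is the
  -- convolution with `K`.
  have h := S.voiceL2.inner_map_map (S.π x S.u) v
  rw [L2.inner_def] at h
  rw [voice, ← h]
  refine integral_congr_ae ?_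
  filter_upwards [(S.memLp_voice v).coeFn_toLp, (S.memLp_voice (S.π x S.u)).coeFn_toLp]
    with z h1 h2
  change inner ℂ (MemLp.toLp _ (S.memLp_voice (S.π x S.u)) z) (MemLp.toLp _ (S.memLp_voice v) z) = _
  rw [h1, h2, S.voice_π_u, RCLike.inner_apply, ← S.K_inv, mul_inv_rev, inv_inv]

theorem enorm_voice_le (v : H) (x : G) :
    ‖S.voice v x‖ₑ ≤ ∫⁻ z, ‖S.voice v z‖ₑ * ‖S.K (z⁻¹ * x)‖ₑ ∂β := by
  rw [S.voice_eq_integral v x]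
  refine (enorm_integral_le_lintegral_enorm _).trans (le_of_eq (lintegral_congr fun z => ?_))
  exact enorm_mul _ _

theorem weightedNorm_K_lt_top {p : ℝ} (hp : 1 < p) :
    weightedNorm β p S.w (fun x => ‖S.K x‖ₑ) < ∞ :=
  ((memLpw_iff (by linarith) S.w_continuous.measurable S.w_pos).1 (S.kernel_mem p hp)).2

/-- `|K| * |K| ∈ L_{p,w}` for `1 < p < ∞`. -/
theorem weightedNorm_K_convolution_lt_top {p : ℝ} (hp : 1 < p) :
    weightedNorm β p S.w (fun x => ∫⁻ y, ‖S.K y‖ₑ * ‖S.K (y⁻¹ * x)‖ₑ ∂β) < ∞ := by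
  have hp0 : 0 < p := by linarith
  -- Solves `2/a = 1 + 1/p`, so Young's inequality applies with both exponents equal to `a`; `a > 1`
  -- because `p > 1`. The reflected norm is no new condition, as `w` and `|K|` are invariant under
  -- inversion.
  set a : ℝ := 2 * p / (p + 1) with ha
  have ha1 : 1 < a := by rw [ha, lt_div_iff₀ (by linarith)]; linarith
  have hrel : 1 / a + 1 / a = 1 + 1 / p := by rw [ha]; field_simp; ring
  have hKm : Measurable fun x => ‖S.K x‖ₑ := S.continuous_K.measurable.enorm
  refine (weightedNorm_convolution_le ha1.le ha1.le hp0 hrel S.w_continuous.measurable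
    S.w_continuous.measurable (fun x => (S.w_pos x).le) S.w_mul hKm hKm).trans_lt ?_
  have h := S.weightedNorm_K_lt_top ha1
  refine ENNReal.mul_lt_top h (max_lt h ?_)
  simp only [S.w_inv, S.enorm_K_inv]
  exact h

end Setting

end Kernel

end Coorbit

namespace Coorbit

/-! ### Oscillation of the kernel -/

section Oscillation

variable {G : Type*} [Group G] [TopologicalSpace G] [IsTopologicalGroup G]
  [LocallyCompactSpace G] [SecondCountableTopology G] [MeasurableSpace G] [BorelSpace G]
  {β : Measure G} [β.IsHaarMeasure] {H : Type*} [NormedAddCommGroup H] [InnerProductSpace ℂ H]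
  (S : Setting β H)

namespace Setting

theorem bddAbove_osc (Q : Set G) (x : G) :
    BddAbove (range fun u : Q => ‖S.K (u * x) - S.K x‖) := by
  refine ⟨‖S.u‖ * ‖S.u‖ + ‖S.u‖ * ‖S.u‖, ?_⟩
  rintro _ ⟨u, rfl⟩
  exact (norm_sub_le _ _).trans (add_le_add (S.norm_K_le _) (S.norm_K_le _))

/-- The supremum may be uncountable, but a bounded supremum of continuous functions is lower
semicontinuous. -/
theorem measurable_osc (Q : Set G) : Measurable (osc Q S.K) := by
  refine LowerSemicontinuous.measurable ?_
  exact lowerSemicontinuous_ciSup (S.bddAbove_osc Q) fun u => Continuous.lowerSemicontinuous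
    (((S.continuous_K.comp (continuous_const_mul (u : G))).sub S.continuous_K).norm)

theorem norm_K_mul_le {Q : Set G} {u : G} (hu : u ∈ Q) (x : G) :
    ‖S.K (u * x)‖ ≤ osc Q S.K x + ‖S.K x‖ := by
  have h1 : ‖S.K (u * x) - S.K x‖ ≤ osc Q S.K x := le_ciSup (S.bddAbove_osc Q x) ⟨u, hu⟩
  have h2 := norm_sub_norm_le (S.K (u * x)) (S.K x)
  linarith

end Setting

end Oscillation

/-! ### Step functions and the passage from sums to convolutions -/

section Synthesis

variable {G : Type*} [Group G] [TopologicalSpace G] [IsTopologicalGroup G] [T2Space G]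
  [LocallyCompactSpace G] [SecondCountableTopology G] [MeasurableSpace G] [BorelSpace G]
  {β : Measure G} [β.IsHaarMeasure] {H : Type*} [NormedAddCommGroup H] [InnerProductSpace ℂ H]
  (S : Setting β H) (D : Discretization β)

namespace Discretization

theorem one_mem (n : ℕ) : (1 : G) ∈ D.Q n := mem_of_mem_nhds (D.Q_nhds n)

theorem measure_Q_ne_zero (n : ℕ) : β (D.Q n) ≠ 0 :=
  (Measure.measure_pos_of_mem_nhds β (D.Q_nhds n)).ne'

theorem measure_Q_ne_top (n : ℕ) : β (D.Q n) ≠ ∞ := (D.Q_compact n).measure_lt_top.ne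

theorem measurableSet_smul_Q (n : ℕ) (x : G) : MeasurableSet (x • D.Q n) :=
  ((D.Q_compact n).smul x).isClosed.measurableSet

/-- The step function `∑ |d_y| 1_{y Q}`. -/
noncomputable def stepFunction (n : ℕ) (d : D.Y n → ℂ) (x : G) : ℝ≥0∞ :=
  ∑' y : D.Y n, ‖d y‖ₑ * ((y : G) • D.Q n).indicator 1 x

theorem measurable_stepFunction (n : ℕ) (d : D.Y n → ℂ) : Measurable (D.stepFunction n d) := by
  have := (D.Y_countable n).to_subtype
  exact Measurable.tsum fun y =>
    (measurable_one.indicator (D.measurableSet_smul_Q n y)).const_mul _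

/-- Each point lies in at most `I` of the sets `y Q`. -/
theorem exists_finset_mem_smul (n : ℕ) (x : G) :
    ∃ s : Finset (D.Y n), (∀ y : D.Y n, x ∈ (y : G) • D.Q n → y ∈ s) ∧ s.card ≤ D.I := by
  have h : ∀ y : D.Y n, ∃ i, (y : G) ∈ D.Z n i := fun y =>
    mem_iUnion.1 ((D.Y_eq n).subset y.2)
  choose i hi using h
  -- Two sets `yQ` from the same class that share `x` coincide, so the class index separates the `y`
  -- in question.
  have hinj : InjOn i {y : D.Y n | x ∈ (y : G) • D.Q n} := by
    intro y hy y' hy' hyy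
    refine Subtype.ext ((D.separated n (i y) y (hi y) y' (hyy ▸ hi y')).1 ⟨x, hy, hy'⟩)
  have hfin : {y : D.Y n | x ∈ (y : G) • D.Q n}.Finite := Finite.of_finite_image (toFinite _) hinj
  refine ⟨hfin.toFinset, fun y hy => hfin.mem_toFinset.2 hy, ?_⟩
  have := Finset.card_le_card_of_injOn (s := hfin.toFinset) (t := Finset.univ) i
    (fun _ _ => Finset.mem_coe.2 (Finset.mem_univ _)) (by simpa using hinj)
  simpa using this

/-- At most `I` terms are nonzero at `x`, so convexity of `t ↦ t^q` costs the factor `I^(q-1)`. -/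
theorem stepFunction_rpow_le (n : ℕ) (d : D.Y n → ℂ) {q : ℝ} (hq : 1 ≤ q) (x : G) :
    D.stepFunction n d x ^ q ≤ (D.I : ℝ≥0∞) ^ (q - 1) *
      ∑' y : D.Y n, ‖d y‖ₑ ^ q * ((y : G) • D.Q n).indicator 1 x := by
  obtain ⟨s, hs, hcard⟩ := D.exists_finset_mem_smul n x
  have hout : ∀ y : D.Y n, y ∉ s → ((y : G) • D.Q n).indicator (1 : G → ℝ≥0∞) x = 0 :=
    fun y hy => indicator_of_notMem (fun h => hy (hs y h)) _
  rw [stepFunction, tsum_eq_sum (s := s) fun y hy => by rw [hout y hy, mul_zero],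
    tsum_eq_sum (s := s) fun y hy => by rw [hout y hy, mul_zero]]
  refine (ENNReal.rpow_sum_le_const_mul_sum_rpow s _ hq).trans ?_
  refine mul_le_mul' (ENNReal.rpow_le_rpow (by exact_mod_cast hcard) (by linarith))
    (Finset.sum_le_sum fun y _ => ?_)
  rw [ENNReal.mul_rpow_of_nonneg _ _ (by linarith)]
  gcongr
  by_cases h : x ∈ (y : G) • D.Q n
  · simp [h]
  · simp [h, show 0 < q by linarith]

end Discretization

namespace Setting

theorem bddAbove_w (n : ℕ) : BddAbove (range fun q : D.Q n => S.w q) := by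
  have := (D.Q_compact n).bddAbove_image S.w_continuous.continuousOn
  rwa [image_eq_range] at this

theorem w_le_iSup (n : ℕ) {q : G} (hq : q ∈ D.Q n) : S.w q ≤ ⨆ q : D.Q n, S.w q :=
  le_ciSup (S.bddAbove_w D n) ⟨q, hq⟩

theorem iSup_w_pos (n : ℕ) : 0 < ⨆ q : D.Q n, S.w q :=
  (S.w_pos 1).trans_le (S.w_le_iSup D n (D.one_mem n))

/-- On `yQ` the weight satisfies `m ≤ (sup_Q w) m y`, and all `yQ` have the measure of `Q`; the
pointwise power bound is integrated term by term. -/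
theorem weightedNorm_stepFunction_le {m : G → ℝ} (hm : IsModerate S.w m) {q : ℝ} (hq : 1 ≤ q)
    (n : ℕ) (d : D.Y n → ℂ) :
    weightedNorm β q m (D.stepFunction n d) ≤
      β (D.Q n) ^ (1 / q) * (D.I : ℝ≥0∞) ^ (1 - 1 / q) * ENNReal.ofReal (⨆ y : D.Q n, S.w y) *
        (∑' y : D.Y n, (‖d y‖ₑ * ENNReal.ofReal (m y)) ^ q) ^ (1 / q) := by
  have hq0 : 0 < q := by linarith
  have hcount := (D.Y_countable n).to_subtype
  set W := ⨆ y : D.Q n, S.w y with hW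
  set A := ∑' y : D.Y n, (‖d y‖ₑ * ENNReal.ofReal (m y)) ^ q with hA
  have hpt : ∀ x, (ENNReal.ofReal (m x) * D.stepFunction n d x) ^ q ≤
      (D.I : ℝ≥0∞) ^ (q - 1) * ∑' y : D.Y n, ENNReal.ofReal W ^ q *
        (‖d y‖ₑ * ENNReal.ofReal (m y)) ^ q * ((y : G) • D.Q n).indicator 1 x := fun x => by
    rw [ENNReal.mul_rpow_of_nonneg _ _ hq0.le]
    calc _ ≤ ENNReal.ofReal (m x) ^ q * _ :=
          mul_le_mul_right (D.stepFunction_rpow_le n d hq x) _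
      _ = (D.I : ℝ≥0∞) ^ (q - 1) * ∑' y : D.Y n, ENNReal.ofReal (m x) ^ q *
          (‖d y‖ₑ ^ q * ((y : G) • D.Q n).indicator 1 x) := by
          rw [ENNReal.tsum_mul_left]; ring
      _ ≤ _ := by
          refine mul_le_mul_right (ENNReal.tsum_le_tsum fun y => ?_) _
          by_cases h : x ∈ (y : G) • D.Q n
          · obtain ⟨v, hv, rfl⟩ := h
            have h1 : m ((y : G) • v) ≤ W * m y := by
              rw [mul_comm]
              exact (hm.right _ _).trans
                (mul_le_mul_of_nonneg_left (S.w_le_iSup D n hv) (hm.pos _).le)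
            have h2 : ENNReal.ofReal (m ((y : G) • v)) ≤
                ENNReal.ofReal W * ENNReal.ofReal (m y) := by
              rw [← ENNReal.ofReal_mul (S.iSup_w_pos D n).le]
              exact ENNReal.ofReal_le_ofReal h1
            rw [← mul_assoc]
            refine mul_le_mul_left ?_ _
            rw [← ENNReal.mul_rpow_of_nonneg _ _ hq0.le, ← ENNReal.mul_rpow_of_nonneg _ _ hq0.le]
            refine ENNReal.rpow_le_rpow ?_ hq0.le
            calc _ ≤ ENNReal.ofReal W * ENNReal.ofReal (m y) * ‖d y‖ₑ := mul_le_mul_left h2 _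
              _ = _ := by ring
          · simp [h]
  have hint : ∫⁻ x, (ENNReal.ofReal (m x) * D.stepFunction n d x) ^ q ∂β ≤
      (D.I : ℝ≥0∞) ^ (q - 1) * (ENNReal.ofReal W ^ q * A * β (D.Q n)) := by
    refine (lintegral_mono hpt).trans (le_of_eq ?_)
    have hmeas : ∀ y : D.Y n, Measurable (((y : G) • D.Q n).indicator (1 : G → ℝ≥0∞)) :=
      fun y => measurable_one.indicator (D.measurableSet_smul_Q n y)
    rw [lintegral_const_mul _ (Measurable.tsum fun y => (hmeas y).const_mul _),
      lintegral_tsum fun y => ((hmeas y).const_mul _).aemeasurable]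
    congr 1
    have : ∀ y : D.Y n, ∫⁻ x, ENNReal.ofReal W ^ q * (‖d y‖ₑ * ENNReal.ofReal (m y)) ^ q *
        ((y : G) • D.Q n).indicator 1 x ∂β =
        ENNReal.ofReal W ^ q * (‖d y‖ₑ * ENNReal.ofReal (m y)) ^ q * β (D.Q n) := fun y => by
      rw [lintegral_const_mul _ (hmeas y), lintegral_indicator_one (D.measurableSet_smul_Q n y),
        measure_smul]
    simp only [this]
    rw [ENNReal.tsum_mul_right, ENNReal.tsum_mul_left]
  refine (ENNReal.rpow_le_rpow hint (by positivity)).trans (le_of_eq ?_)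
  have e : (q - 1) * (1 / q) = 1 - 1 / q := by field_simp
  rw [ENNReal.mul_rpow_of_nonneg _ _ (by positivity),
    ENNReal.mul_rpow_of_nonneg _ _ (by positivity),
    ENNReal.mul_rpow_of_nonneg _ _ (by positivity), ← ENNReal.rpow_mul, ← ENNReal.rpow_mul, e,
    mul_one_div_cancel hq0.ne', ENNReal.rpow_one]
  ring

/-- The majorant `∑ |d_y| |K (y⁻¹ z)|` of the voice transform of `∑ d_y π(y) u`. -/
noncomputable def absSum (n : ℕ) (d : D.Y n → ℂ) (z : G) : ℝ≥0∞ :=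
  ∑' y : D.Y n, ‖d y‖ₑ * ‖S.K ((y : G)⁻¹ * z)‖ₑ

theorem measurable_absSum (n : ℕ) (d : D.Y n → ℂ) : Measurable (S.absSum D n d) := by
  have := (D.Y_countable n).to_subtype
  exact Measurable.tsum fun y =>
    ((S.continuous_K.comp (continuous_const_mul (y : G)⁻¹)).measurable.enorm).const_mul _

theorem measurable_oscSum (n : ℕ) : Measurable fun x => ‖osc (D.Q n) S.K x + ‖S.K x‖‖ₑ :=
  ((S.measurable_osc _).add S.continuous_K.measurable.norm).enorm

/-- For `x = yv` with `v ∈ Q` one has `y⁻¹z = v (x⁻¹z)`, so the oscillation at `x⁻¹z` controls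
`K(y⁻¹z)` uniformly over `x ∈ yQ`. Integrating over `yQ` gives the factor `β Q`. -/
theorem measure_mul_absSum_le (n : ℕ) (d : D.Y n → ℂ) (z : G) :
    β (D.Q n) * S.absSum D n d z ≤
      ∫⁻ x, D.stepFunction n d x * ‖osc (D.Q n) S.K (x⁻¹ * z) + ‖S.K (x⁻¹ * z)‖‖ₑ ∂β := by
  have hcount := (D.Y_countable n).to_subtype
  have hmeas : ∀ y : D.Y n, Measurable (((y : G) • D.Q n).indicator (1 : G → ℝ≥0∞)) :=
    fun y => measurable_one.indicator (D.measurableSet_smul_Q n y)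
  have hg : Measurable fun x : G => ‖osc (D.Q n) S.K (x⁻¹ * z) + ‖S.K (x⁻¹ * z)‖‖ₑ :=
    (S.measurable_oscSum D n).comp (measurable_inv.mul_const z)
  simp only [Discretization.stepFunction, ← ENNReal.tsum_mul_right]
  have hmeas' : ∀ y : D.Y n, AEMeasurable (fun x => ‖d y‖ₑ * ((y : G) • D.Q n).indicator 1 x *
      ‖osc (D.Q n) S.K (x⁻¹ * z) + ‖S.K (x⁻¹ * z)‖‖ₑ) β :=
    fun y => (((hmeas y).const_mul _).mul hg).aemeasurable
  rw [lintegral_tsum hmeas', absSum, ← ENNReal.tsum_mul_left]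
  refine ENNReal.tsum_le_tsum fun y => ?_
  calc β (D.Q n) * (‖d y‖ₑ * ‖S.K ((y : G)⁻¹ * z)‖ₑ)
      = ∫⁻ x, ‖d y‖ₑ * ((y : G) • D.Q n).indicator 1 x * ‖S.K ((y : G)⁻¹ * z)‖ₑ ∂β := by
        rw [lintegral_mul_const _ ((hmeas y).const_mul _), lintegral_const_mul _ (hmeas y),
          lintegral_indicator_one (D.measurableSet_smul_Q n y), measure_smul]
        ring
    _ ≤ _ := by
        refine lintegral_mono fun x => ?_
        by_cases h : x ∈ (y : G) • D.Q n
        · obtain ⟨v, hv, rfl⟩ := h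
          refine mul_le_mul_right ?_ _
          have h1 := S.norm_K_mul_le hv (((y : G) • v)⁻¹ * z)
          have h2 : v * (((y : G) • v)⁻¹ * z) = (y : G)⁻¹ * z := by
            simp [mul_assoc]
          rw [h2] at h1
          rw [← ofReal_norm, ← ofReal_norm]
          exact ENNReal.ofReal_le_ofReal (h1.trans (Real.le_norm_self _))
        · simp [h]

end Setting

end Synthesis

end Coorbit

namespace Coorbit

/-! ### Norm bound and convergence of atomic series -/

section Synthesis

variable {G : Type*} [Group G] [TopologicalSpace G] [IsTopologicalGroup G] [T2Space G]
  [LocallyCompactSpace G] [SecondCountableTopology G] [MeasurableSpace G] [BorelSpace G]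
  {β : Measure G} [β.IsHaarMeasure] {H : Type*} [NormedAddCommGroup H] [InnerProductSpace ℂ H]
  (S : Setting β H) (D : Discretization β)

namespace Setting

theorem ofReal_seqNorm {m : G → ℝ} (hm0 : ∀ x, 0 ≤ m x) {q : ℝ} (hq : 0 < q) {s : Set G}
    {d : s → ℂ} (hd : MemSeq m q d) :
    ENNReal.ofReal (seqNorm m q d) =
      (∑' y : s, (‖d y‖ₑ * ENNReal.ofReal (m y)) ^ q) ^ (1 / q) := by
  have h0 : ∀ y : s, 0 ≤ (‖d y‖ * m y) ^ q := fun y =>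
    Real.rpow_nonneg (mul_nonneg (norm_nonneg _) (hm0 y)) q
  rw [seqNorm, ← ENNReal.ofReal_rpow_of_nonneg (tsum_nonneg h0) (by positivity),
    ENNReal.ofReal_tsum_of_nonneg h0 hd]
  congr 1
  refine tsum_congr fun y => ?_
  rw [← ENNReal.ofReal_rpow_of_nonneg (mul_nonneg (norm_nonneg _) (hm0 y)) hq.le,
    ENNReal.ofReal_mul (norm_nonneg _), ofReal_norm]

section

variable {p : ℝ} (hp : 1 ≤ p) (hK : MemLpw β p (S.twistedWeight p) S.K)
include hp hK

/-- The twisted norm is the plain norm of the reflected function, and `|K|` and `w` are invariant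
under inversion. This covers `p = 1`, where the setting gives no integrability. -/
theorem memLpw_K_of_twisted : MemLpw β p S.w S.K := by
  have hp0 : 0 < p := by linarith
  rw [memLpw_iff hp0 (S.measurable_twistedWeight p) (S.twistedWeight_pos p),
    ← lintegral_inv_eq_weightedNorm_twisted S hp0 S.continuous_K.measurable.enorm] at hK
  simp only [S.w_inv, S.enorm_K_inv] at hK
  exact (memLpw_iff hp0 S.w_continuous.measurable S.w_pos).2 hK

variable {n : ℕ} (hosc : MemLpw β p S.w (osc (D.Q n) S.K) ∧
  MemLpw β p (S.twistedWeight p) (osc (D.Q n) S.K))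
include hosc

/-- The real norms are defined through `toReal`, which sends `∞` to `0`; the hypotheses are needed
to exclude this. -/
theorem ofReal_constTheta :
    ENNReal.ofReal (S.constTheta D p n) =
      max (weightedNorm β p S.w fun x => ‖osc (D.Q n) S.K x + ‖S.K x‖‖ₑ)
        (weightedNorm β p (S.twistedWeight p) fun x => ‖osc (D.Q n) S.K x + ‖S.K x‖‖ₑ) := by
  have hp0 : 0 < p := by linarith
  have h1 : MemLpw β p S.w fun x => osc (D.Q n) S.K x + ‖S.K x‖ :=
    hosc.1.add (S.memLpw_K_of_twisted hp hK).norm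
  have h2 : MemLpw β p (S.twistedWeight p) fun x => osc (D.Q n) S.K x + ‖S.K x‖ :=
    hosc.2.add hK.norm
  rw [constTheta, normLpw, normLpw, ENNReal.ofReal_max, ENNReal.ofReal_toReal h1.2.ne,
    ENNReal.ofReal_toReal h2.2.ne,
    eLpNorm_weightedMeasure hp0 S.w_continuous.measurable fun x => (S.w_pos x).le,
    eLpNorm_weightedMeasure hp0 (S.measurable_twistedWeight p)
      fun x => (S.twistedWeight_pos p x).le]

/-- The central estimate of part (ii): domination by a convolution, weighted Young, and the step
function bound. It controls absolute values, hence every rearrangement and every tail. -/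
theorem weightedNorm_absSum_le {m : G → ℝ} (hm : IsModerate S.w m) {q r : ℝ} (hq : 1 ≤ q)
    (hr : 0 < r) (h : 1 / q + 1 / p = 1 + 1 / r) {d : D.Y n → ℂ} (hd : MemSeq m q d) :
    weightedNorm β r m (S.absSum D n d) ≤
      ENNReal.ofReal (S.constD D p q n * seqNorm m q d) := by
  have hp0 : 0 < p := by linarith
  have hq0 : 0 < q := by linarith
  have hb0 := D.measure_Q_ne_zero n
  have hbt := D.measure_Q_ne_top n
  have hbr : 0 < β.real (D.Q n) := ENNReal.toReal_pos hb0 hbt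
  have hb : 0 ≤ 1 - 1 / q := by rw [sub_nonneg, div_le_one hq0]; exact hq
  have h1 : β (D.Q n) * weightedNorm β r m (S.absSum D n d) ≤
      β (D.Q n) ^ (1 / q) * (D.I : ℝ≥0∞) ^ (1 - 1 / q) * ENNReal.ofReal (⨆ y : D.Q n, S.w y) *
        ENNReal.ofReal (seqNorm m q d) * ENNReal.ofReal (S.constTheta D p n) := by
    rw [← weightedNorm_const_mul hr hbt]
    refine (weightedNorm_mono hr (Eventually.of_forall fun z =>
      S.measure_mul_absSum_le D n d z)).trans ?_
    refine (weightedNorm_convolution_le hp hq hr h S.w_continuous.measurable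
      hm.continuous.measurable (fun x => (hm.pos x).le) hm.right (D.measurable_stepFunction n d)
      (S.measurable_oscSum D n)).trans ?_
    rw [lintegral_inv_eq_weightedNorm_twisted S hp0 (S.measurable_oscSum D n),
      ← S.ofReal_constTheta D hp hK hosc, ofReal_seqNorm (fun x => (hm.pos x).le) hq0 hd]
    exact mul_le_mul_left (S.weightedNorm_stepFunction_le D hm hq n d) _
  have hθ : 0 ≤ S.constTheta D p n := le_max_of_le_left ENNReal.toReal_nonneg
  have hs : 0 ≤ seqNorm m q d := Real.rpow_nonneg (tsum_nonneg fun y =>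
    Real.rpow_nonneg (mul_nonneg (norm_nonneg _) (hm.pos _).le) q) _
  have hW := (S.iSup_w_pos D n).le
  have hI : (0 : ℝ) ≤ D.I := Nat.cast_nonneg _
  -- Cancelling `β Q`, positive and finite, turns its exponent `1/q` into `1/q - 1`.
  refine (ENNReal.mul_le_mul_iff_right hb0 hbt).1 (h1.trans (le_of_eq ?_))
  have e : β (D.Q n) = ENNReal.ofReal (β.real (D.Q n)) := (ENNReal.ofReal_toReal hbt).symm
  have e' : (D.I : ℝ≥0∞) = ENNReal.ofReal (D.I : ℝ) := (ENNReal.ofReal_natCast _).symm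
  rw [e, e', ENNReal.ofReal_rpow_of_nonneg hbr.le (by positivity),
    ENNReal.ofReal_rpow_of_nonneg hI hb, ← ENNReal.ofReal_mul (by positivity),
    ← ENNReal.ofReal_mul (by positivity), ← ENNReal.ofReal_mul (by positivity),
    ← ENNReal.ofReal_mul (by positivity), ← ENNReal.ofReal_mul (by positivity), constD,
    Real.rpow_sub hbr, Real.rpow_one]
  congr 1
  field_simp

end

theorem atom_apply (x : G) (v : S.TestSpace) :
    S.atom x v = starRingEnd ℂ (S.voice (S.incl v) x) :=
  (inner_conj_symm _ _).symm

theorem atom_testAtom (x z : G) : S.atom x (S.testAtom z) = S.K (x⁻¹ * z) :=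
  (S.K_inv_mul z x).symm

theorem extVoice_sub_sum {ι : Type*} (T : S.TestDual) (s : Finset ι) (a : ι → ℂ) (x : ι → G)
    (z : G) : S.extVoice (T - ∑ i ∈ s, a i • S.atom (x i)) z =
      S.extVoice T z - ∑ i ∈ s, a i * S.K ((x i)⁻¹ * z) := by
  simp only [extVoice, sub_apply, sum_apply, smul_apply, smul_eq_mul, atom_testAtom]

/-- A distribution whose voice transform is `∑ d_y K (y⁻¹ z)` lies in the coorbit space. -/
theorem mem_Co_of_hasSum {m : G → ℝ} (hm : IsModerate S.w m) {r C : ℝ} (hr : 0 < r) (hC : 0 ≤ C)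
    {n : ℕ} {d : D.Y n → ℂ} (hd : weightedNorm β r m (S.absSum D n d) ≤ ENNReal.ofReal C)
    {T : S.TestDual}
    (hT : ∀ z, HasSum (fun y : D.Y n => d y * S.K ((y : G)⁻¹ * z)) (S.extVoice T z)) :
    T ∈ S.Co m r ∧ S.coNorm m r T ≤ C := by
  have := (D.Y_countable n).to_subtype
  have hmeas : AEStronglyMeasurable (S.extVoice T) β := by
    refine aestronglyMeasurable_of_tendsto_ae atTop
      (f := fun s : Finset (D.Y n) => fun z => ∑ y ∈ s, d y * S.K ((y : G)⁻¹ * z))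
      (fun s => ?_) (Eventually.of_forall fun z => hT z)
    refine (continuous_finsetSum s fun y _ => ?_).aestronglyMeasurable
    exact continuous_const.mul (S.continuous_K.comp (continuous_const_mul (y : G)⁻¹))
  have hle : weightedNorm β r m (fun z => ‖S.extVoice T z‖ₑ) ≤ ENNReal.ofReal C := by
    refine (weightedNorm_mono hr (Eventually.of_forall fun z => ?_)).trans hd
    rw [← (hT z).tsum_eq]
    refine enorm_tsum_le_tsum_enorm.trans (le_of_eq ?_)
    simp only [enorm_mul, absSum]
  refine ⟨(memLpw_iff hr hm.continuous.measurable hm.pos).2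
    ⟨hmeas, hle.trans_lt ENNReal.ofReal_lt_top⟩, ?_⟩
  rw [coNorm, normLpw_eq hr hm.continuous.measurable fun x => (hm.pos x).le]
  exact ENNReal.toReal_le_of_le_ofReal hC hle

/-- The series `∑ d_y ⟨π(y) u, v⟩` is bounded by a seminorm of the test space. -/
theorem tsum_enorm_voice_le {m : G → ℝ} (hm : IsModerate S.w m) {r r' : ℝ}
    (hr : r.HolderConjugate r') (n : ℕ) (d : D.Y n → ℂ) (v : H) :
    ∑' y : D.Y n, ‖d y‖ₑ * ‖S.voice v y‖ₑ ≤ ENNReal.ofReal (m 1)⁻¹ *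
      (weightedNorm β r' S.w (fun x => ‖S.voice v x‖ₑ) *
        weightedNorm β r m (S.absSum D n d)) := by
  have := (D.Y_countable n).to_subtype
  have hVm : Measurable fun z => ‖S.voice v z‖ₑ := (S.continuous_voice v).measurable.enorm
  refine le_trans ?_ (lintegral_mul_le_weightedNorm hr S.w_continuous.measurable
    hm.continuous.measurable (hm.pos 1) (hm.one_le_mul S) (fun x => (hm.pos x).le)
    hVm.aemeasurable (S.measurable_absSum D n d).aemeasurable)
  have hmeas : ∀ y : D.Y n, Measurable fun z => ‖S.voice v z‖ₑ *
      (‖d y‖ₑ * ‖S.K ((y : G)⁻¹ * z)‖ₑ) := fun y => hVm.mul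
    (((S.continuous_K.comp (continuous_const_mul (y : G)⁻¹)).measurable.enorm).const_mul _)
  simp only [absSum, ← ENNReal.tsum_mul_left]
  rw [lintegral_tsum fun y => (hmeas y).aemeasurable]
  refine ENNReal.tsum_le_tsum fun y => ?_
  -- Point values of `V v` are replaced by the integral of `|V v(z)| |K(z⁻¹y)|`, and the symmetry of
  -- `|K|` turns the sum over `y` into `absSum` at `z`.
  refine (mul_le_mul_right (S.enorm_voice_le v y) _).trans (le_of_eq ?_)
  rw [← lintegral_const_mul' _ _ enorm_ne_top]
  refine lintegral_congr fun z => ?_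
  rw [← S.enorm_K_inv, mul_inv_rev, inv_inv]
  ring

/-- The distribution `∑ d_y π(y) u`. -/
theorem exists_hasSum_atom {m : G → ℝ} (hm : IsModerate S.w m) {r : ℝ} (hr : 1 < r) {n : ℕ}
    {d : D.Y n → ℂ} (hd : weightedNorm β r m (S.absSum D n d) < ∞) :
    ∃ T : S.TestDual, ∀ v, HasSum (fun y : D.Y n => d y * S.atom (y : G) v) (T v) := by
  -- As `1 < r' < ∞`, the exponent `r'` indexes a seminorm of the test space, and this one seminorm
  -- bounds the limit functional.
  obtain ⟨r', hrr⟩ : ∃ r', r.HolderConjugate r' := ⟨_, Real.HolderConjugate.conjExponent hr⟩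
  set A : ℝ≥0∞ := ENNReal.ofReal (m 1)⁻¹ * weightedNorm β r m (S.absSum D n d) with hA
  have hAt : A ≠ ∞ := ENNReal.mul_ne_top ENNReal.ofReal_ne_top hd.ne
  have hV : ∀ v : S.TestSpace, ∑' y : D.Y n, ‖d y * S.atom (y : G) v‖ₑ ≤
      A * ENNReal.ofReal (S.testSeminorm ⟨r', hrr.symm.lt⟩ v) := fun v => by
    have hv : MemLpw β r' S.w (S.voice (S.incl v)) := v.2 r' hrr.symm.lt
    have h1 : ENNReal.ofReal (S.testSeminorm ⟨r', hrr.symm.lt⟩ v) =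
        weightedNorm β r' S.w (fun x => ‖S.voice (S.incl v) x‖ₑ) := by
      rw [← eLpNorm_weightedMeasure hrr.symm.pos S.w_continuous.measurable
        fun x => (S.w_pos x).le]
      exact ENNReal.ofReal_toReal hv.2.ne
    rw [h1]
    have h2 := S.tsum_enorm_voice_le D hm hrr n d (S.incl v)
    calc _ = ∑' y : D.Y n, ‖d y‖ₑ * ‖S.voice (S.incl v) y‖ₑ := by
          refine tsum_congr fun y => ?_
          rw [enorm_mul, atom_apply, ← ofReal_norm, ← ofReal_norm, RCLike.norm_conj, ofReal_norm,
            ofReal_norm]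
      _ ≤ _ := h2
      _ = _ := by rw [hA]; ring
  have hsum : ∀ v : S.TestSpace, Summable fun y : D.Y n => d y * S.atom (y : G) v := fun v =>
    Summable.of_enorm (ne_top_of_le_ne_top (ENNReal.mul_ne_top hAt ENNReal.ofReal_ne_top) (hV v))
  let f : S.TestSpace →ₛₗ[starRingEnd ℂ] ℂ :=
    { toFun := fun v => ∑' y : D.Y n, d y * S.atom (y : G) v
      map_add' := fun a b => by
        rw [← (hsum a).tsum_add (hsum b)]
        refine tsum_congr fun y => ?_
        rw [map_add, mul_add]
      map_smul' := fun c a => by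
        rw [smul_eq_mul, ← tsum_mul_left]
        refine tsum_congr fun y => ?_
        rw [map_smulₛₗ, smul_eq_mul]
        ring }
  have hw : WithSeminorms (𝕜 := ℂ) (fun p => S.testSeminorm p) := ⟨rfl⟩
  have hcont : Continuous f := by
    refine hw.continuous_normedSpace_rng ℂ f ⟨{⟨r', hrr.symm.lt⟩}, A.toNNReal, fun v => ?_⟩
    simp only [Finset.sup_singleton]
    change ‖f v‖ ≤ (A.toNNReal : ℝ) * S.testSeminorm ⟨r', hrr.symm.lt⟩ v
    have h3 : ‖f v‖ₑ ≤ A * ENNReal.ofReal (S.testSeminorm ⟨r', hrr.symm.lt⟩ v) :=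
      enorm_tsum_le_tsum_enorm.trans (hV v)
    have h4 := ENNReal.toReal_mono (ENNReal.mul_ne_top hAt ENNReal.ofReal_ne_top) h3
    rwa [toReal_enorm, ENNReal.toReal_mul, ENNReal.toReal_ofReal (apply_nonneg _ _)] at h4
  exact ⟨⟨f, hcont⟩, fun v => (hsum v).hasSum⟩

theorem tendsto_seqNorm_compl {m : G → ℝ} {q : ℝ} (hq : 0 < q) {Y : Set G} [DecidableEq Y]
    (d : Y → ℂ) :
    Tendsto (fun s : Finset Y => seqNorm m q fun y => if y ∈ s then 0 else d y) atTop (𝓝 0) := by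
  -- No summability is needed: a divergent sum and its tails are `0` by convention.
  have h := tendsto_tsum_compl_atTop_zero fun y : Y => (‖d y‖ * m y) ^ q
  have h2 := h.rpow_const (p := 1 / q) (Or.inr (by positivity))
  rw [Real.zero_rpow (by positivity)] at h2
  refine h2.congr fun s => ?_
  rw [seqNorm]
  congr 1
  have := tsum_subtype {y : Y | y ∉ s} fun y : Y => (‖d y‖ * m y) ^ q
  refine Eq.trans this (tsum_congr fun y => ?_)
  by_cases hy : y ∈ s
  · simp [hy, Real.zero_rpow hq.ne']
  · simp [hy]

theorem memSeq_compl {m : G → ℝ} {q : ℝ} (hq : 0 < q) {Y : Set G} [DecidableEq Y]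
    {d : Y → ℂ} (hd : MemSeq m q d) (s : Finset Y) :
    MemSeq m q fun y => if y ∈ s then 0 else d y := by
  refine (hd.indicator {y : Y | y ∉ s}).congr fun y => ?_
  by_cases hy : y ∈ s
  · simp [hy, Real.zero_rpow hq.ne']
  · simp [hy]

theorem synthesis {m : G → ℝ} (hm : IsModerate S.w m) {p q r : ℝ} (hr : 1 < r) (hp : 1 ≤ p)
    (hpr : p < r) (hK : MemLpw β p (S.twistedWeight p) S.K) {n : ℕ}
    (hosc : MemLpw β p S.w (osc (D.Q n) S.K) ∧ MemLpw β p (S.twistedWeight p) (osc (D.Q n) S.K))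
    (h : 1 / q + 1 / p = 1 + 1 / r) {d : D.Y n → ℂ} (hd : MemSeq m q d) :
    ∃ T ∈ S.Co m r,
      (∀ v : S.TestSpace, HasSum (fun x : D.Y n => d x * S.atom (x : G) v) (T v)) ∧
      Tendsto (fun s : Finset (D.Y n) => S.coNorm m r (T - ∑ x ∈ s, d x • S.atom (x : G)))
        atTop (𝓝 0) ∧
      S.coNorm m r T ≤ S.constD D p q n * seqNorm m q d := by
  classical
  have hp0 : 0 < p := by linarith
  have hr0 : 0 < r := by linarith
  -- From `1/q = 1 + 1/r - 1/p`: `p ≥ 1` makes this positive, and `p < r` makes it less than one.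
  have hq : 1 ≤ q := by
    have h1 : 1 / p ≤ 1 := by rw [div_le_one hp0]; exact hp
    have h2 : 1 / r < 1 / p := one_div_lt_one_div_of_lt hp0 hpr
    have h3 : 0 < 1 / r := by positivity
    have h4 : 0 < q := one_div_pos.1 (by linarith)
    rw [← div_le_one h4]
    linarith
  have hq0 : 0 < q := by linarith
  have hD : 0 ≤ S.constD D p q n := by
    have := (S.iSup_w_pos D n).le
    have hθ : 0 ≤ S.constTheta D p n := le_max_of_le_left ENNReal.toReal_nonneg
    unfold constD
    positivity
  have hs : ∀ d : D.Y n → ℂ, 0 ≤ seqNorm m q d := fun d =>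
    Real.rpow_nonneg (tsum_nonneg fun y =>
      Real.rpow_nonneg (mul_nonneg (norm_nonneg _) (hm.pos _).le) q) _
  have hbound := fun (d : D.Y n → ℂ) (hd : MemSeq m q d) =>
    S.weightedNorm_absSum_le D hp hK hosc hm hq hr0 h hd
  obtain ⟨T, hT⟩ := S.exists_hasSum_atom D hm hr ((hbound d hd).trans_lt ENNReal.ofReal_lt_top)
  have hTz : ∀ z, HasSum (fun y : D.Y n => d y * S.K ((y : G)⁻¹ * z)) (S.extVoice T z) :=
    fun z => by
      have := hT (S.testAtom z)
      simp only [atom_testAtom] at this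
      exact this
  have hmain := S.mem_Co_of_hasSum D hm hr0 (mul_nonneg hD (hs d)) (hbound d hd) hTz
  refine ⟨T, hmain.1, hT, ?_, hmain.2⟩
  -- The error after summing over `s` is the series with coefficients set to zero on `s`, so the
  -- norm bound applies to it.
  have hlim := (tendsto_seqNorm_compl (m := m) hq0 d).const_mul (S.constD D p q n)
  rw [mul_zero] at hlim
  refine squeeze_zero (fun s => ENNReal.toReal_nonneg) (fun s => ?_) hlim
  refine (S.mem_Co_of_hasSum D hm hr0 (mul_nonneg hD (hs _))
    (hbound _ (memSeq_compl hq0 hd s)) fun z => ?_).2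
  rw [S.extVoice_sub_sum]
  have h1 : HasSum (fun y : D.Y n => if y ∈ s then d y * S.K ((y : G)⁻¹ * z) else 0)
      (∑ y ∈ s, d y * S.K ((y : G)⁻¹ * z)) := by
    have := hasSum_sum_of_ne_finset_zero (L := SummationFilter.unconditional (D.Y n)) (s := s)
      (f := fun y : D.Y n => if y ∈ s then d y * S.K ((y : G)⁻¹ * z) else 0)
      (fun y hy => by simp [hy])
    rwa [Finset.sum_congr rfl fun y hy => if_pos hy] at this
  refine ((hTz z).sub h1).congr_fun fun y => ?_
  by_cases hy : y ∈ s <;> simp [hy]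

end Setting

end Synthesis

end Coorbit

namespace Coorbit

/-! ### Dominated convergence in weighted norms -/

section Convergence

variable {G : Type*} [MeasurableSpace G] {β : Measure G}

theorem tendsto_weightedNorm_zero {ι : Type*} {l : Filter ι} [l.IsCountablyGenerated] {p : ℝ}
    (hp : 0 < p) {w : G → ℝ} (hw : Measurable w) {F : ι → G → ℝ≥0∞} {bound : G → ℝ≥0∞}
    (hF : ∀ᶠ i in l, Measurable (F i)) (hb : weightedNorm β p w bound < ∞)
    (hle : ∀ᶠ i in l, ∀ᵐ x ∂β, F i x ≤ bound x)
    (hlim : ∀ᵐ x ∂β, Tendsto (fun i => F i x) l (𝓝 0)) :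
    Tendsto (fun i => weightedNorm β p w (F i)) l (𝓝 0) := by
  have h0 : Tendsto (fun i => ∫⁻ x, (ENNReal.ofReal (w x) * F i x) ^ p ∂β) l
      (𝓝 (∫⁻ _, 0 ∂β)) := by
    refine tendsto_lintegral_filter_of_dominated_convergence
      (fun x => (ENNReal.ofReal (w x) * bound x) ^ p) ?_ ?_ ?_ ?_
    · filter_upwards [hF] with i hi
      exact (hw.ennreal_ofReal.mul hi).pow_const p
    · filter_upwards [hle] with i hi
      filter_upwards [hi] with x hx
      gcongr
    · rw [← weightedNorm_rpow hp]
      exact ENNReal.rpow_ne_top_of_nonneg hp.le hb.ne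
    · filter_upwards [hlim] with x hx
      have h1 := ENNReal.Tendsto.const_mul (a := ENNReal.ofReal (w x)) hx
        (Or.inr ENNReal.ofReal_ne_top)
      have h2 := h1.ennrpow_const p
      rwa [mul_zero, ENNReal.zero_rpow_of_pos hp] at h2
  rw [lintegral_zero] at h0
  have h3 := h0.ennrpow_const (1 / p)
  rwa [ENNReal.zero_rpow_of_pos (by positivity)] at h3

theorem eLpNorm_eq_weightedNorm_one {E : Type*} [NormedAddCommGroup E] {p : ℝ} (hp : 0 < p)
    (f : G → E) :
    eLpNorm f (ENNReal.ofReal p) β = weightedNorm β p (fun _ => 1) fun x => ‖f x‖ₑ := by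
  rw [eLpNorm_eq_lintegral_rpow_enorm_toReal (by simpa using hp) ENNReal.ofReal_ne_top,
    ENNReal.toReal_ofReal hp.le, weightedNorm]
  simp only [ENNReal.ofReal_one, one_mul]

theorem weightedNorm_eq_eLpNorm_mul {p : ℝ} (hp : 0 < p) {w : G → ℝ} (hw0 : ∀ x, 0 ≤ w x)
    (f : G → ℂ) :
    weightedNorm β p w (fun x => ‖f x‖ₑ) =
      eLpNorm (fun x => (w x : ℂ) * f x) (ENNReal.ofReal p) β := by
  rw [eLpNorm_eq_weightedNorm_one hp, weightedNorm, weightedNorm]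
  simp only [ENNReal.ofReal_one, one_mul, enorm_mul]
  congr 1
  refine lintegral_congr fun x => ?_
  rw [← ofReal_norm (w x : ℂ), Complex.norm_of_nonneg (hw0 x)]

end Convergence

/-! ### Continuity of translation of the kernel -/

section Translation

variable {G : Type*} [Group G] [TopologicalSpace G] [IsTopologicalGroup G]
  [LocallyCompactSpace G] [SecondCountableTopology G] [MeasurableSpace G] [BorelSpace G]
  {β : Measure G} [β.IsHaarMeasure] {H : Type*} [NormedAddCommGroup H] [InnerProductSpace ℂ H]
  (S : Setting β H)

namespace Setting

theorem memLp_shifted_weight_mul_K {m : G → ℝ} (hm : IsModerate S.w m) {r : ℝ} (hr : 1 < r)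
    (x : G) : MemLp (fun y => (m (x * y) : ℂ) * S.K y) (ENNReal.ofReal r) β := by
  have hr0 : 0 < r := by linarith
  have hmx : Continuous fun y => m (x * y) := hm.continuous.comp (continuous_const_mul x)
  refine ⟨((Complex.continuous_ofReal.comp hmx).mul S.continuous_K).aestronglyMeasurable, ?_⟩
  rw [← weightedNorm_eq_eLpNorm_mul hr0 fun y => (hm.pos _).le]
  refine lt_of_le_of_lt ?_ (ENNReal.mul_lt_top (ENNReal.ofReal_lt_top (r := m x))
    (S.weightedNorm_K_lt_top hr))
  rw [← weightedNorm_const_mul hr0 ENNReal.ofReal_ne_top]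
  refine ENNReal.rpow_le_rpow (lintegral_mono fun y => ENNReal.rpow_le_rpow ?_ hr0.le)
    (by positivity)
  calc _ ≤ ENNReal.ofReal (m x * S.w y) * ‖S.K y‖ₑ :=
        mul_le_mul_left (ENNReal.ofReal_le_ofReal (hm.right x y)) _
    _ = _ := by rw [ENNReal.ofReal_mul (hm.pos x).le]; ring

/-- After the substitution `y ↦ xy` the kernel stays fixed and only the continuous weight moves, so
dominated convergence applies. -/
theorem continuous_shifted_weight_mul_K {m : G → ℝ} (hm : IsModerate S.w m) {r : ℝ}
    [hr : Fact (1 < r)] :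
    Continuous fun x => (S.memLp_shifted_weight_mul_K hm hr.out x).toLp := by
  have hr0 : 0 < r := zero_lt_one.trans hr.out
  refine continuous_iff_continuousAt.2 fun x₀ => ?_
  rw [ContinuousAt, Lp.tendsto_Lp_iff_tendsto_eLpNorm'']
  -- Near `x₀` one has `m x < m x₀ + 1`; moderateness bounds the two weights by `(m x₀ + 1) w y` and
  -- `m x₀ w y`.
  set bound : G → ℝ≥0∞ := fun y =>
    ENNReal.ofReal (m x₀ + 1 + m x₀) * (ENNReal.ofReal (S.w y) * ‖S.K y‖ₑ) with hbound
  have hmx : ∀ x, Continuous fun y => (m (x * y) : ℂ) := fun x =>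
    Complex.continuous_ofReal.comp (hm.continuous.comp (continuous_const_mul x))
  refine (tendsto_weightedNorm_zero (β := β) (w := fun _ => 1) hr0 measurable_const
    (F := fun x y => ‖(m (x * y) : ℂ) * S.K y - (m (x₀ * y) : ℂ) * S.K y‖ₑ) (bound := bound)
    (Eventually.of_forall fun x => ?_) ?_ ?_ (Eventually.of_forall fun y => ?_)).congr fun x => ?_
  · exact (((hmx x).mul S.continuous_K).sub ((hmx x₀).mul S.continuous_K)).measurable.enorm
  · rw [hbound, weightedNorm_const_mul hr0 ENNReal.ofReal_ne_top]
    refine ENNReal.mul_lt_top ENNReal.ofReal_lt_top ?_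
    have h := S.weightedNorm_K_lt_top hr.out
    rw [weightedNorm] at h ⊢
    simpa only [ENNReal.ofReal_one, one_mul] using h
  · have h1 : ∀ᶠ x in 𝓝 x₀, m x < m x₀ + 1 :=
      hm.continuous.continuousAt.eventually_lt_const (by linarith)
    filter_upwards [h1] with x hx
    refine Eventually.of_forall fun y => ?_
    rw [← sub_mul, enorm_mul, hbound]
    dsimp only
    rw [← mul_assoc, ← ENNReal.ofReal_mul (by linarith [hm.pos x₀])]
    refine mul_le_mul_left ?_ _
    rw [← ofReal_norm, ← Complex.ofReal_sub, Complex.norm_real]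
    refine ENNReal.ofReal_le_ofReal ((norm_sub_le _ _).trans ?_)
    rw [Real.norm_of_nonneg (hm.pos _).le, Real.norm_of_nonneg (hm.pos _).le]
    have h2 := hm.right x y
    have h3 := hm.right x₀ y
    have h4 := S.w_pos y
    nlinarith
  · have hc : Continuous fun x => ‖(m (x * y) : ℂ) * S.K y - (m (x₀ * y) : ℂ) * S.K y‖ₑ :=
      continuous_enorm.comp (((Complex.continuous_ofReal.comp
        (hm.continuous.comp (continuous_mul_const y))).mul continuous_const).sub continuous_const)
    simpa using hc.tendsto x₀
  · rw [eLpNorm_eq_weightedNorm_one hr0]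
    rfl

theorem coeFn_translateK {m : G → ℝ} (hm : IsModerate S.w m) {r : ℝ} [hr : Fact (1 < r)] (x : G) :
    S.translateK hm r x =ᵐ[β] fun y => S.K (x⁻¹ * y) :=
  (weight_ac r hm.continuous hm.pos).ae_le (MemLp.coeFn_toLp _)

/-- `m · λ(x)K` is the translate by `x` of `y ↦ m(xy) K(y)`, a continuous family in unweighted
`L_r`, on which translation acts jointly continuously. Multiplication by `m` transfers this to
`L_{r,m}`. -/
theorem continuous_translateK {m : G → ℝ} (hm : IsModerate S.w m) {r : ℝ} [hr : Fact (1 < r)] :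
    Continuous (S.translateK hm r) := by
  have hr0 : 0 < r := zero_lt_one.trans hr.out
  let τ : G → C(G, G) := fun x => ⟨fun y => x⁻¹ * y, continuous_const_mul x⁻¹⟩
  have hτ : Continuous τ := by
    refine ContinuousMap.continuous_of_continuous_uncurry _ ?_
    exact continuous_fst.inv.mul continuous_snd
  have hτm : ∀ x, MeasurePreserving (τ x) β β := fun x => measurePreserving_mul_left β x⁻¹
  have hc := (S.continuous_shifted_weight_mul_K hm (r := r)).compMeasurePreservingLp hτ hτm
    ENNReal.ofReal_ne_top
  refine continuous_iff_continuousAt.2 fun x₀ => ?_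
  have h1 := hc.tendsto x₀
  rw [Lp.tendsto_Lp_iff_tendsto_eLpNorm'] at h1
  rw [ContinuousAt, Lp.tendsto_Lp_iff_tendsto_eLpNorm']
  refine h1.congr fun x => ?_
  have h0 : (S.translateK hm r x : G → ℂ) - (S.translateK hm r x₀ : G → ℂ) =ᵐ[weightedMeasure β r m]
      fun y => S.K (x⁻¹ * y) - S.K (x₀⁻¹ * y) :=
    weightedMeasure_ac.ae_le ((S.coeFn_translateK hm x).sub (S.coeFn_translateK hm x₀))
  rw [eLpNorm_congr_ae h0,
    eLpNorm_weightedMeasure hr0 hm.continuous.measurable fun x => (hm.pos x).le,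
    weightedNorm_eq_eLpNorm_mul hr0 fun x => (hm.pos x).le]
  have key : ∀ x, (Lp.compMeasurePreserving (τ x) (hτm x)
      (S.memLp_shifted_weight_mul_K hm hr.out x).toLp : G → ℂ) =ᵐ[β]
      fun y => (m y : ℂ) * S.K (x⁻¹ * y) := fun x => by
    refine (Lp.coeFn_compMeasurePreserving _ _).trans ?_
    have h2 := (hτm x).quasiMeasurePreserving.ae_eq_comp
      (S.memLp_shifted_weight_mul_K hm hr.out x).coeFn_toLp
    refine h2.trans (Eventually.of_forall fun y => ?_)
    change (m (x * (x⁻¹ * y)) : ℂ) * S.K (x⁻¹ * y) = _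
    rw [mul_inv_cancel_left]
  refine eLpNorm_congr_ae ?_
  filter_upwards [key x, key x₀] with y h2 h3
  rw [Pi.sub_apply, h2, h3, mul_sub]

end Setting

end Translation

end Coorbit

/-! ### Analysis: approximation from the spaces `V_n` and coefficient bounds -/

namespace Coorbit

/-- Choose `g n` within `1/(n+1)` of the optimal distance; monotonicity makes that distance tend to
zero. -/
theorem exists_tendsto_of_mem_closure_iUnion {X : Type*} [PseudoMetricSpace X] {V : ℕ → Set X}
    (hV : Monotone V) (hne : ∀ n, (V n).Nonempty) {f : X} (hf : f ∈ closure (⋃ n, V n)) :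
    ∃ g : ℕ → X, (∀ n, g n ∈ V n) ∧ Tendsto g atTop (𝓝 f) := by
  have h1 : ∀ n : ℕ, ∃ g ∈ V n, dist f g < Metric.infDist f (V n) + 1 / ((n : ℝ) + 1) :=
    fun n => (Metric.infDist_lt_iff (hne n)).1 (by linarith [Nat.one_div_pos_of_nat (α := ℝ) (n := n)])
  choose g hg hd using h1
  refine ⟨g, hg, ?_⟩
  have h2 : Tendsto (fun n => Metric.infDist f (V n)) atTop (𝓝 0) := by
    rw [Metric.tendsto_atTop]
    intro ε hε
    obtain ⟨y, hy, hyd⟩ := Metric.mem_closure_iff.1 hf ε hε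
    obtain ⟨N, hN⟩ := mem_iUnion.1 hy
    refine ⟨N, fun n hn => ?_⟩
    rw [Real.dist_0_eq_abs, abs_of_nonneg Metric.infDist_nonneg]
    exact (Metric.infDist_le_dist_of_mem (hV hn hN)).trans_lt hyd
  have h3 := h2.add tendsto_one_div_add_atTop_nhds_zero_nat
  rw [add_zero] at h3
  rw [tendsto_iff_dist_tendsto_zero]
  exact squeeze_zero (fun n => dist_nonneg) (fun n => by rw [dist_comm]; exact (hd n).le) h3

section Approximation

variable {G : Type*} [Group G] [TopologicalSpace G] [IsTopologicalGroup G] [T2Space G]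
  [LocallyCompactSpace G] [SecondCountableTopology G] [MeasurableSpace G] [BorelSpace G]
  {β : Measure G} [β.IsHaarMeasure] {H : Type*} [NormedAddCommGroup H] [InnerProductSpace ℂ H]
  (S : Setting β H) (D : Discretization β)

namespace Discretization

theorem ψ_eq_zero {n : ℕ} {x : G} (hx : x ∈ D.Y n) {y : G} (hy : y ∉ x • D.Q n) :
    D.ψ n x y = 0 := by
  by_contra h
  exact hy (D.ψ_support n x hx (subset_tsupport _ h))

theorem memLpw_ψ {m : G → ℝ} (hc : Continuous m) (hpos : ∀ x, 0 < m x) {r : ℝ} (hr : 0 < r)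
    {n : ℕ} {x : G} (hx : x ∈ D.Y n) : MemLpw β r m fun y => (D.ψ n x y : ℂ) := by
  have hL : IsCompact (x • D.Q n) := (D.Q_compact n).smul x
  obtain ⟨C, hC⟩ := hL.bddAbove_image hc.continuousOn
  refine (memLpw_iff hr hc.measurable hpos).2
    ⟨(Complex.measurable_ofReal.comp (D.ψ_measurable n x hx)).aestronglyMeasurable, ?_⟩
  refine ENNReal.rpow_lt_top_of_nonneg (by positivity) (ne_of_lt ?_)
  calc _ ≤ ∫⁻ y, (x • D.Q n).indicator (fun _ => ENNReal.ofReal C ^ r) y ∂β := by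
        refine lintegral_mono fun y => ?_
        by_cases hy : y ∈ x • D.Q n
        · rw [indicator_of_mem hy]
          refine ENNReal.rpow_le_rpow ?_ hr.le
          dsimp only
          rw [← ofReal_norm, Complex.norm_real, Real.norm_of_nonneg (D.ψ_nonneg n x hx y),
            ← ENNReal.ofReal_mul (hpos y).le]
          refine ENNReal.ofReal_le_ofReal ?_
          have h1 := hC (mem_image_of_mem m hy)
          have h2 := D.ψ_le_one n x hx y
          nlinarith [hpos y]
        · simp [D.ψ_eq_zero hx hy, hr]
    _ < ∞ := by
        rw [lintegral_indicator_const (D.measurableSet_smul_Q n x)]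
        exact ENNReal.mul_lt_top (ENNReal.rpow_lt_top_of_nonneg hr.le ENNReal.ofReal_ne_top)
          hL.measure_lt_top

theorem sum_ψ_le_one (n : ℕ) (y : G) : ∑ x ∈ D.X n, D.ψ n x y ≤ 1 := by
  let ι : D.X n ↪ D.Y n := ⟨fun x => ⟨x, D.X_subset n x.2⟩, fun a b h =>
    Subtype.ext (congrArg (fun z : D.Y n => (z : G)) h)⟩
  have h := sum_le_hasSum (Finset.univ.map ι) (fun x _ => D.ψ_nonneg n x x.2 y) (D.ψ_sum n y)
  rw [Finset.sum_map] at h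
  rw [← Finset.sum_coe_sort]
  exact h

end Discretization

/-- The functionals `F ↦ ∫ F ψ_x`, `x ∈ X_n`, take arbitrary values. -/
theorem exists_integral_mul_ψ_eq {m : G → ℝ} (hc : Continuous m) (hpos : ∀ x, 0 < m x) {r : ℝ}
    [hr : Fact (1 < r)] (n : ℕ) (b : D.X n → ℂ) :
    ∃ F : Lpw β r m, ∀ x : D.X n, ∫ y, F y * (D.ψ n x y : ℂ) ∂β = b x := by
  classical
  have hr0 : 0 < r := zero_lt_one.trans hr.out
  have hY : ∀ x : D.X n, (x : G) ∈ D.Y n := fun x => D.X_subset n x.2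
  have hI : ∀ (x : D.X n) (F : Lpw β r m), Integrable (fun y => F y * (D.ψ n x y : ℂ)) β :=
    fun x F => integrable_mul_ψ D hc hpos r n (hY x) F
  let L : Lpw β r m →ₗ[ℂ] D.X n → ℂ :=
    { toFun := fun F x => ∫ y, F y * (D.ψ n x y : ℂ) ∂β
      map_add' := fun F F' => by
        funext x
        rw [Pi.add_apply, ← integral_add (hI x F) (hI x F')]
        refine integral_congr_ae ?_
        filter_upwards [(weight_ac r hc hpos).ae_le (Lp.coeFn_add F F')] with y hy
        rw [hy, Pi.add_apply, add_mul]
      map_smul' := fun c F => by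
        funext x
        rw [RingHom.id_apply, Pi.smul_apply, smul_eq_mul, ← integral_const_mul]
        refine integral_congr_ae ?_
        filter_upwards [(weight_ac r hc hpos).ae_le (Lp.coeFn_smul c F)] with y hy
        rw [hy, Pi.smul_apply, smul_eq_mul, mul_assoc] }
  suffices h : LinearMap.range L = ⊤ by
    obtain ⟨F, hF⟩ := LinearMap.range_eq_top.1 h b
    exact ⟨F, fun x => congrFun hF x⟩
  -- If some values are missed, a nonzero functional with coefficients `α` annihilates the range.
  -- Testing it on the conjugate of `∑ α_x ψ_x` gives `∫ |∑ α_x ψ_x|² = 0`, contradicting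
  -- independence.
  by_contra hne
  obtain ⟨φ, hφ0, hφ⟩ := Submodule.exists_le_ker_of_lt_top _ (lt_top_iff_ne_top.2 hne)
  refine hφ0 ?_
  let α : D.X n → ℂ := fun x => φ fun j => if x = j then 1 else 0
  have hφα : ∀ v, φ v = ∑ x, v x * α x := fun v => by
    rw [LinearMap.pi_apply_eq_sum_univ φ v]
    rfl
  let Φ : Lpw β r m := ∑ x : D.X n, starRingEnd ℂ (α x) • (D.memLpw_ψ hc hpos hr0 (hY x)).toLp
  have hΦ : Φ =ᵐ[β] fun y => starRingEnd ℂ (∑ x : D.X n, α x * (D.ψ n x y : ℂ)) := by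
    have h1 : ∀ x : D.X n, (MemLp.toLp _ (D.memLpw_ψ hc hpos hr0 (hY x)) : Lpw β r m) =ᵐ[β]
        fun y => (D.ψ n x y : ℂ) := fun x => (weight_ac r hc hpos).ae_le (MemLp.coeFn_toLp _)
    have h2 := (weight_ac (β := β) r hc hpos).ae_le (Lp.coeFn_fun_finsetSum (Finset.univ)
      (fun x : D.X n => starRingEnd ℂ (α x) • (D.memLpw_ψ hc hpos hr0 (hY x)).toLp))
    have h3 : ∀ x : D.X n, _ := fun x => (weight_ac (β := β) r hc hpos).ae_le
      (Lp.coeFn_smul (starRingEnd ℂ (α x)) (MemLp.toLp _ (D.memLpw_ψ hc hpos hr0 (hY x))))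
    filter_upwards [h2, eventually_all.2 h1, eventually_all.2 h3] with y e2 e1 e3
    rw [e2, map_sum]
    refine Finset.sum_congr rfl fun x _ => ?_
    rw [e3 x, Pi.smul_apply, e1 x, smul_eq_mul, map_mul, Complex.conj_ofReal]
  have hint : ∀ x : D.X n, Integrable (fun y => α x * (Φ y * (D.ψ n x y : ℂ))) β :=
    fun x => (hI x Φ).const_mul _
  have h0 : ∫ y, ∑ x : D.X n, α x * (Φ y * (D.ψ n x y : ℂ)) ∂β = 0 := by
    have h1 : φ (L Φ) = 0 := hφ ⟨Φ, rfl⟩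
    rw [hφα] at h1
    rw [integral_finsetSum _ fun x _ => hint x, ← h1]
    refine Finset.sum_congr rfl fun x _ => ?_
    rw [integral_const_mul, mul_comm]
    rfl
  have hsq : (fun y => ∑ x : D.X n, α x * (Φ y * (D.ψ n x y : ℂ))) =ᵐ[β]
      fun y => ((‖∑ x : D.X n, α x * (D.ψ n x y : ℂ)‖ ^ 2 : ℝ) : ℂ) := by
    filter_upwards [hΦ] with y hy
    rw [Complex.ofReal_pow, ← Complex.conj_mul', ← hy, Finset.mul_sum]
    exact Finset.sum_congr rfl fun x _ => by ring
  have hsqi : Integrable (fun y => ‖∑ x : D.X n, α x * (D.ψ n x y : ℂ)‖ ^ 2) β := by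
    exact ((integrable_finsetSum Finset.univ fun x _ => hint x).congr hsq).re
  rw [integral_congr_ae hsq, integral_complex_ofReal, Complex.ofReal_eq_zero,
    integral_eq_zero_iff_of_nonneg (fun y => by positivity) hsqi] at h0
  have hzero := D.ψ_independent n (D.X n) (fun x => if h : x ∈ D.X n then α ⟨x, h⟩ else 0)
    (D.X_subset n) (by
      filter_upwards [h0] with y hy
      rw [← Finset.sum_coe_sort]
      simpa using hy)
  refine LinearMap.ext fun v => ?_
  rw [hφα, LinearMap.zero_apply]
  refine Finset.sum_eq_zero fun x _ => ?_
  have := hzero x x.2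
  rw [dif_pos x.2] at this
  rw [this, mul_zero]

namespace Setting

variable {m : G → ℝ} (hm : IsModerate S.w m) {r : ℝ} [hr : Fact (1 < r)]

/-- An `F` whose integrals against the `ψ_y` are a Kronecker delta is mapped to `λ(x)K`. Hence `V_n`
is the whole span, and the `V_n` increase although the `ψ` change with `n`. -/
theorem translateK_mem_V {n : ℕ} {x : G} (hx : x ∈ D.X n) :
    S.translateK hm r x ∈ S.V D hm r n := by
  classical
  obtain ⟨F, hF⟩ := exists_integral_mul_ψ_eq D hm.continuous hm.pos (r := r) n
    fun y => if (y : G) = x then 1 else 0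
  refine ⟨F, ?_⟩
  change ∑ y ∈ D.X n, (∫ z, F z * (D.ψ n y z : ℂ) ∂β) • S.translateK hm r y = _
  rw [Finset.sum_eq_single x (fun y hy hyx => by rw [hF ⟨y, hy⟩, if_neg hyx, zero_smul])
    (fun h => (h hx).elim), hF ⟨x, hx⟩, if_pos rfl, one_smul]

theorem V_mono : Monotone fun n => S.V D hm r n := by
  refine monotone_nat_of_le_succ fun n => ?_
  rintro _ ⟨F, rfl⟩
  exact Submodule.sum_mem _ fun x hx =>
    Submodule.smul_mem _ _ (S.translateK_mem_V D hm (D.X_mono n hx))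

/-- An arbitrary translate is a limit of translates by points of `⋃ X_n`, by density of these points
and continuity of translation. -/
theorem span_translateK_subset :
    closure (Submodule.span ℂ (range (S.translateK hm r)) : Set (Lpw β r m)) ⊆
      closure (⋃ n, (S.V D hm r n : Set (Lpw β r m))) := by
  have hU : (⋃ n, (S.V D hm r n : Set (Lpw β r m))) = ((⨆ n, S.V D hm r n : Submodule ℂ _) :
      Set (Lpw β r m)) :=
    (Submodule.coe_iSup_of_directed _ (S.V_mono D hm).directed_le).symm
  refine closure_minimal ?_ isClosed_closure
  rw [hU, ← Submodule.topologicalClosure_coe]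
  refine Submodule.span_le.2 ?_
  rintro _ ⟨x, rfl⟩
  rw [Submodule.topologicalClosure_coe, ← hU]
  have hx : x ∈ closure (⋃ n, (D.X n : Set G)) := by rw [D.X_dense]; exact mem_univ x
  refine map_mem_closure (S.continuous_translateK hm) hx fun y hy => ?_
  obtain ⟨n, hn⟩ := mem_iUnion.1 hy
  exact mem_iUnion.2 ⟨n, S.translateK_mem_V D hm hn⟩

include hm in
-- Hölder's inequality for the measure `ψ_x dy`, of mass at most `β Q`. The factor `ψ_x` is kept on
-- the right so that the sum over `x` can use `∑ ψ_x ≤ 1`.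
theorem enorm_integral_mul_ψ_rpow_le {n : ℕ} {x : G} (hx : x ∈ D.Y n) {F : G → ℂ}
    (hF : AEStronglyMeasurable F β) :
    (‖∫ y, F y * (D.ψ n x y : ℂ) ∂β‖ₑ * ENNReal.ofReal (m x)) ^ r ≤
      (ENNReal.ofReal (⨆ q : D.Q n, S.w q) * β (D.Q n) ^ (1 - 1 / r)) ^ r *
        ∫⁻ y, (ENNReal.ofReal (m y) * ‖F y‖ₑ) ^ r * ENNReal.ofReal (D.ψ n x y) ∂β := by
  have hr0 : 0 < r := zero_lt_one.trans hr.out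
  have hr1 : 0 ≤ 1 - 1 / r := by
    rw [sub_nonneg, div_le_one hr0]; exact hr.out.le
  set W := ⨆ q : D.Q n, S.w q with hW
  set I := ∫⁻ y, (ENNReal.ofReal (m y) * ‖F y‖ₑ) ^ r * ENNReal.ofReal (D.ψ n x y) ∂β with hI
  have hψm := (D.ψ_measurable n x hx).ennreal_ofReal
  have h1 : ‖∫ y, F y * (D.ψ n x y : ℂ) ∂β‖ₑ * ENNReal.ofReal (m x) ≤
      ENNReal.ofReal W * ∫⁻ y, ENNReal.ofReal (m y) * ‖F y‖ₑ * ENNReal.ofReal (D.ψ n x y) ∂β := by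
    refine (mul_le_mul_left (enorm_integral_le_lintegral_enorm _) _).trans ?_
    rw [← lintegral_mul_const' _ _ ENNReal.ofReal_ne_top,
      ← lintegral_const_mul' _ _ ENNReal.ofReal_ne_top]
    refine lintegral_mono fun y => ?_
    rw [enorm_mul, ← ofReal_norm (D.ψ n x y : ℂ), Complex.norm_of_nonneg (D.ψ_nonneg n x hx y)]
    by_cases hy : y ∈ x • D.Q n
    · obtain ⟨v, hv, rfl⟩ := hy
      have h2 : m x ≤ W * m (x • v) := by
        -- Writing `x = (xv)v⁻¹` and using `w v⁻¹ = w v` compares `m x` with `m` on `xQ`.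
        have h3 := hm.right (x * v) v⁻¹
        rw [mul_inv_cancel_right, S.w_inv] at h3
        rw [mul_comm]
        exact h3.trans (mul_le_mul_of_nonneg_left (S.w_le_iSup D n hv) (hm.pos _).le)
      have h4 := ENNReal.ofReal_le_ofReal h2
      rw [ENNReal.ofReal_mul (S.iSup_w_pos D n).le] at h4
      calc _ ≤ ‖F (x • v)‖ₑ * ENNReal.ofReal (D.ψ n x (x • v)) *
            (ENNReal.ofReal W * ENNReal.ofReal (m (x • v))) := mul_le_mul_right h4 _
        _ = _ := by ring
    · simp [D.ψ_eq_zero hx hy]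
  have h5 : ∫⁻ y, ENNReal.ofReal (D.ψ n x y) ∂β ≤ β (D.Q n) := by
    rw [← measure_smul (μ := β) x (D.Q n),
      ← lintegral_indicator_one (D.measurableSet_smul_Q n x)]
    refine lintegral_mono fun y => ?_
    by_cases hy : y ∈ x • D.Q n
    · rw [indicator_of_mem hy]
      simpa using D.ψ_le_one n x hx y
    · simp [D.ψ_eq_zero hx hy]
  have h6 : ∫⁻ y, ENNReal.ofReal (m y) * ‖F y‖ₑ * ENNReal.ofReal (D.ψ n x y) ∂β ≤
      I ^ (1 / r) * β (D.Q n) ^ (1 - 1 / r) := by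
    have h7 := ENNReal.lintegral_mul_norm_pow_le (μ := β)
      (f := fun y => (ENNReal.ofReal (m y) * ‖F y‖ₑ) ^ r * ENNReal.ofReal (D.ψ n x y))
      (g := fun y => ENNReal.ofReal (D.ψ n x y))
      (((hm.continuous.measurable.ennreal_ofReal.aemeasurable.mul hF.enorm).pow_const r).mul
        hψm.aemeasurable) hψm.aemeasurable (p := 1 / r) (q := 1 - 1 / r) (by positivity) hr1
        (by ring)
    refine le_trans (le_of_eq (lintegral_congr fun y => ?_)) (h7.trans ?_)
    · rw [ENNReal.mul_rpow_of_nonneg _ _ (by positivity), ← ENNReal.rpow_mul,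
        mul_one_div_cancel hr0.ne', ENNReal.rpow_one, mul_assoc (_ * _) (_ ^ _) (_ ^ _),
        ← ENNReal.rpow_add_of_nonneg _ _ (by positivity) hr1]
      simp
    · gcongr
  calc _ ≤ (ENNReal.ofReal W * (I ^ (1 / r) * β (D.Q n) ^ (1 - 1 / r))) ^ r :=
        ENNReal.rpow_le_rpow (h1.trans (mul_le_mul_right h6 _)) hr0.le
    _ = (ENNReal.ofReal W * β (D.Q n) ^ (1 - 1 / r) * I ^ (1 / r)) ^ r := by ring_nf
    _ = _ := by
        rw [ENNReal.mul_rpow_of_nonneg _ _ hr0.le, ← ENNReal.rpow_mul I,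
          one_div_mul_cancel hr0.ne', ENNReal.rpow_one]

include hm in
/-- The coefficients `∫ F ψ_x` are controlled by the norm of `F`. -/
theorem coefficients_le (n : ℕ) (F : Lpw β r m) :
    (∑ x : D.X n, (‖∫ y, F y * (D.ψ n x y : ℂ) ∂β‖ * m x) ^ r) ^ (1 / r) ≤
      β.real (D.Q n) ^ (1 - 1 / r) * (⨆ q : D.Q n, S.w q) * ‖F‖ := by
  have hr0 : 0 < r := zero_lt_one.trans hr.out
  have hr1 : 0 ≤ 1 - 1 / r := by
    rw [sub_nonneg, div_le_one hr0]; exact hr.out.le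
  have hW := (S.iSup_w_pos D n).le
  have hFm : AEStronglyMeasurable F β :=
    (Lp.memLp F).1.mono_ac (weight_ac r hm.continuous hm.pos)
  set C := ENNReal.ofReal (⨆ q : D.Q n, S.w q) * β (D.Q n) ^ (1 - 1 / r) with hC
  have h1 : ∑ x : D.X n, (‖∫ y, F y * (D.ψ n x y : ℂ) ∂β‖ₑ * ENNReal.ofReal (m x)) ^ r ≤
      C ^ r * weightedNorm β r m (fun y => ‖F y‖ₑ) ^ r := by
    refine (Finset.sum_le_sum fun x _ =>
      S.enorm_integral_mul_ψ_rpow_le D hm (D.X_subset n x.2) hFm).trans ?_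
    rw [← Finset.mul_sum]
    refine mul_le_mul_right ?_ _
    have hmeas : ∀ x ∈ (Finset.univ : Finset (D.X n)), AEMeasurable (fun y =>
        (ENNReal.ofReal (m y) * ‖F y‖ₑ) ^ r * ENNReal.ofReal (D.ψ n x y)) β := fun x _ =>
      ((hm.continuous.measurable.ennreal_ofReal.aemeasurable.mul hFm.enorm).pow_const r).mul
        (D.ψ_measurable n x (D.X_subset n x.2)).ennreal_ofReal.aemeasurable
    rw [← lintegral_finsetSum' _ hmeas, weightedNorm_rpow hr0]
    refine lintegral_mono fun y => ?_
    rw [← Finset.mul_sum, ← ENNReal.ofReal_sum_of_nonneg (s := Finset.univ)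
      (f := fun x : D.X n => D.ψ n x y) fun x _ => D.ψ_nonneg n x (D.X_subset n x.2) y]
    have h2 : ∑ x : D.X n, D.ψ n x y ≤ 1 := by
      rw [Finset.sum_coe_sort (D.X n) fun x => D.ψ n x y]
      exact D.sum_ψ_le_one n y
    refine (mul_le_mul_right (ENNReal.ofReal_le_ofReal h2) _).trans ?_
    simp
  have hnorm : weightedNorm β r m (fun y => ‖F y‖ₑ) = ENNReal.ofReal ‖F‖ := by
    rw [← eLpNorm_weightedMeasure hr0 hm.continuous.measurable fun x => (hm.pos x).le,
      Lp.norm_def, ENNReal.ofReal_toReal (Lp.eLpNorm_ne_top F)]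
  have hCr : C = ENNReal.ofReal (β.real (D.Q n) ^ (1 - 1 / r) * ⨆ q : D.Q n, S.w q) := by
    rw [hC, ENNReal.ofReal_mul (by positivity), mul_comm,
      ← ENNReal.ofReal_rpow_of_nonneg measureReal_nonneg hr1, Measure.real,
      ENNReal.ofReal_toReal (D.measure_Q_ne_top n)]
  have h3 : ENNReal.ofReal (∑ x : D.X n, (‖∫ y, F y * (D.ψ n x y : ℂ) ∂β‖ * m x) ^ r) ≤
      ENNReal.ofReal ((β.real (D.Q n) ^ (1 - 1 / r) * (⨆ q : D.Q n, S.w q) * ‖F‖) ^ r) := by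
    rw [ENNReal.ofReal_sum_of_nonneg fun x _ =>
      Real.rpow_nonneg (mul_nonneg (norm_nonneg _) (hm.pos _).le) _,
      ← ENNReal.ofReal_rpow_of_nonneg (by positivity) hr0.le,
      ENNReal.ofReal_mul (by positivity), ← hCr, ← hnorm, ENNReal.mul_rpow_of_nonneg _ _ hr0.le]
    refine le_trans (le_of_eq (Finset.sum_congr rfl fun x _ => ?_)) h1
    rw [← ENNReal.ofReal_rpow_of_nonneg (mul_nonneg (norm_nonneg _) (hm.pos _).le) hr0.le,
      ENNReal.ofReal_mul (norm_nonneg _), ofReal_norm]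
  have h4 := (ENNReal.ofReal_le_ofReal_iff (by positivity)).1 h3
  have h5 := Real.rpow_le_rpow (Finset.sum_nonneg fun x _ =>
    Real.rpow_nonneg (mul_nonneg (norm_nonneg _) (hm.pos _).le) _) h4
    (show 0 ≤ 1 / r by positivity)
  rwa [← Real.rpow_mul (by positivity), mul_one_div_cancel hr0.ne', Real.rpow_one] at h5

theorem extVoice_sub_sum_ae {T : S.TestDual} (hT : T ∈ S.Co m r) (n : ℕ) (F : Lpw β r m) :
    S.extVoice (T - ∑ x : D.X n, (∫ y, F y * (D.ψ n x y : ℂ) ∂β) • S.atom (x : G)) =ᵐ[β]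
      ((MemLp.toLp _ hT - S.T D hm r n F : Lpw β r m) : G → ℂ) := by
  have hac := weight_ac (β := β) r hm.continuous hm.pos
  have h1 : (S.T D hm r n F : G → ℂ) =ᵐ[β] fun z =>
      ∑ x ∈ D.X n, (∫ y, F y * (D.ψ n x y : ℂ) ∂β) * S.K (x⁻¹ * z) := by
    have h2 := hac.ae_le (Lp.coeFn_fun_finsetSum (D.X n)
      (fun x => (∫ y, F y * (D.ψ n x y : ℂ) ∂β) • S.translateK hm r x))
    have h3 : ∀ x, _ := fun x => hac.ae_le
      (Lp.coeFn_smul (∫ y, F y * (D.ψ n x y : ℂ) ∂β) (S.translateK hm r x))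
    have h4 : ∀ᵐ z ∂β, ∀ x ∈ D.X n,
        ((∫ y, F y * (D.ψ n x y : ℂ) ∂β) • S.translateK hm r x : Lpw β r m) z =
          (∫ y, F y * (D.ψ n x y : ℂ) ∂β) * S.K (x⁻¹ * z) := by
      refine (Finset.eventually_all (D.X n)).2 fun x _ => ?_
      filter_upwards [h3 x, S.coeFn_translateK hm (r := r) x] with z e1 e2
      rw [e1, Pi.smul_apply, e2, smul_eq_mul]
    filter_upwards [h2, h4] with z e2 e4
    refine Eq.trans e2 (Finset.sum_congr rfl e4)
  filter_upwards [h1, hac.ae_le (Lp.coeFn_sub (MemLp.toLp _ hT) (S.T D hm r n F)),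
    hac.ae_le (MemLp.coeFn_toLp hT)] with z e1 e2 e3
  rw [e2, Pi.sub_apply, e1, e3, S.extVoice_sub_sum,
    Finset.sum_coe_sort (D.X n) fun x => (∫ y, F y * (D.ψ n x y : ℂ) ∂β) * S.K (x⁻¹ * z)]

/-- The approximants `g_n` are fixed before the right inverses are given, so the threshold depends
on `T` and `ε` only; the inverses enter through the coefficients alone. -/
theorem approximation {T : S.TestDual} (hT : T ∈ S.Co m r)
    (hcl : (MemLp.toLp _ hT : Lpw β r m) ∈
      closure (Submodule.span ℂ (range (S.translateK hm r)) : Set (Lpw β r m))) :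
    ∃ N : ℝ → ℕ, ∀ R : (n : ℕ) → S.V D hm r n →ₗ[ℂ] Lpw β r m,
      (∀ n, S.toV D hm r n ∘ₗ R n = LinearMap.id) →
      ∃ c : (n : ℕ) → D.X n → ℂ, ∀ ε : ℝ, 0 < ε → ∀ n ≥ N ε,
        T - ∑ x : D.X n, c n x • S.atom (x : G) ∈ S.Co m r ∧
        S.coNorm m r (T - ∑ x : D.X n, c n x • S.atom (x : G)) ≤ ε ∧
        (∑ x : D.X n, (‖c n x‖ * m x) ^ r) ^ (1 / r) ≤
          S.constC D hm r (R n) * (1 + ε) * S.coNorm m r T := by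
  set f : Lpw β r m := MemLp.toLp _ hT with hf
  have hfn : S.coNorm m r T = ‖f‖ := (Lp.norm_toLp _ hT).symm
  obtain ⟨g, hg, N, hN⟩ : ∃ g : ℕ → Lpw β r m, (∀ n, g n ∈ S.V D hm r n) ∧
      ∃ N : ℝ → ℕ, ∀ ε, 0 < ε → ∀ n ≥ N ε, ‖f - g n‖ ≤ ε ∧ ‖f - g n‖ ≤ ε * ‖f‖ := by
    -- For `f = 0` the relative error bound forces `g = 0`, which convergence alone would not
    -- supply.
    rcases eq_or_ne f 0 with h0 | h0
    · refine ⟨fun _ => 0, fun n => Submodule.zero_mem _, fun _ => 0, fun ε hε n _ => ?_⟩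
      simp [h0, hε.le]
    · obtain ⟨g, hg, hlim⟩ := exists_tendsto_of_mem_closure_iUnion
        (V := fun n => (S.V D hm r n : Set (Lpw β r m))) (fun _ _ h => S.V_mono D hm h)
        (fun n => ⟨0, Submodule.zero_mem _⟩) (S.span_translateK_subset D hm hcl)
      have hex : ∀ ε : ℝ, ∃ N : ℕ, 0 < ε → ∀ n ≥ N, ‖f - g n‖ ≤ ε ∧ ‖f - g n‖ ≤ ε * ‖f‖ := by
        intro ε
        by_cases hε : 0 < ε
        · have hpos : 0 < min ε (ε * ‖f‖) := lt_min hε (mul_pos hε (norm_pos_iff.2 h0))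
          obtain ⟨N, hN⟩ := Metric.tendsto_atTop.1 hlim _ hpos
          refine ⟨N, fun _ n hn => ?_⟩
          have := (hN n hn).le
          rw [dist_comm, dist_eq_norm] at this
          exact le_min_iff.1 this
        · exact ⟨0, fun h => (hε h).elim⟩
      choose N hN using hex
      exact ⟨g, hg, N, hN⟩
  refine ⟨N, fun R hR => ?_⟩
  let F : ℕ → Lpw β r m := fun n => R n ⟨g n, hg n⟩
  have hF : ∀ n, S.T D hm r n (F n) = g n := fun n =>
    congrArg Subtype.val (LinearMap.congr_fun (hR n) ⟨g n, hg n⟩)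
  refine ⟨fun n x => ∫ y, F n y * (D.ψ n x y : ℂ) ∂β, fun ε hε n hn => ?_⟩
  obtain ⟨h1, h2⟩ := hN ε hε n hn
  have hae := weightedMeasure_ac (p := r) (w := m) |>.ae_le
    (S.extVoice_sub_sum_ae D hm hT n (F n))
  rw [hF] at hae
  refine ⟨(memLp_congr_ae hae).2 (Lp.memLp _), ?_, ?_⟩
  · refine le_trans (le_of_eq ?_) h1
    rw [coNorm, normLpw, eLpNorm_congr_ae hae, Lp.norm_def]
  · refine (S.coefficients_le D hm n (F n)).trans ?_
    rw [constC, hfn, mul_assoc (_ * _) (1 + ε), mul_assoc (_ * _) _ (_ * _)]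
    have hW := (S.iSup_w_pos D n).le
    refine mul_le_mul_of_nonneg_left ?_ (by positivity)
    have h3 : ‖F n‖ ≤ S.opNorm D hm r (R n) * ‖g n‖ :=
      (LinearMap.toContinuousLinearMap (R n)).le_opNorm ⟨g n, hg n⟩
    refine h3.trans (mul_le_mul_of_nonneg_left ?_
      (norm_nonneg (LinearMap.toContinuousLinearMap (R n))))
    have h4 : ‖g n‖ ≤ ‖f‖ + ‖f - g n‖ := by
      rw [norm_sub_rev]
      exact norm_le_norm_add_norm_sub' _ _
    linarith

end Setting

end Approximation

end Coorbit

/-! ### The reproducing formula for distributions -/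

namespace Coorbit

/-- Closedness makes the quotient by `V` a normed space; the projection commutes with the integral
and kills the integrand. -/
theorem integral_mem_of_isClosed {α E : Type*} [MeasurableSpace α] {μ : Measure α}
    [NormedAddCommGroup E] [NormedSpace ℂ E] [CompleteSpace E] (V : Submodule ℂ E)
    (hV : IsClosed (V : Set E)) {f : α → E} (hf : Integrable f μ) (hfV : ∀ x, f x ∈ V) :
    ∫ x, f x ∂μ ∈ V := by
  have := hV
  have h := V.mkQL.integral_comp_comm hf
  rw [← Submodule.Quotient.mk_eq_zero]
  refine h.symm.trans ?_
  have : ∀ x, V.mkQL (f x) = 0 := fun x => (Submodule.Quotient.mk_eq_zero V).2 (hfV x)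
  simp [this]

section Reproducing

variable {G : Type*} [Group G] [TopologicalSpace G] [IsTopologicalGroup G] [T2Space G]
  [LocallyCompactSpace G] [SecondCountableTopology G] [MeasurableSpace G] [BorelSpace G]
  {β : Measure G} [β.IsHaarMeasure] {H : Type*} [NormedAddCommGroup H] [InnerProductSpace ℂ H]
  (S : Setting β H)

namespace Setting

/-- The space `H × ∏ L_{p,w}` in which finitely many seminorms of the test space are realised. -/
abbrev Ambient (s : Finset {p : ℝ // 1 < p}) : Type _ := H × ((p : s) → Lpw β (p : ℝ) S.w)

instance (s : Finset {p : ℝ // 1 < p}) (p : s) : Fact (1 < ((p : {p : ℝ // 1 < p}) : ℝ)) :=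
  ⟨p.1.2⟩

/-- The pairs of a vector and its voice transform. -/
def graph (s : Finset {p : ℝ // 1 < p}) : Submodule ℂ (S.Ambient s) where
  carrier := {a | ∀ p : s, a.2 p =ᵐ[β] S.voice a.1}
  zero_mem' := fun p => by
    have h : (0 : Lpw β (p : ℝ) S.w) =ᵐ[β] (0 : G → ℂ) :=
      (weight_ac (β := β) (p : ℝ) S.w_continuous S.w_pos).ae_le (Lp.coeFn_zero _ _ _)
    refine h.trans (Eventually.of_forall fun x => ?_)
    simp [voice]
  add_mem' := fun {a b} ha hb p => by
    filter_upwards [ha p, hb p, (weight_ac (β := β) (p : ℝ) S.w_continuous S.w_pos).ae_le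
      (Lp.coeFn_add (a.2 p) (b.2 p))] with x e1 e2 e3
    refine e3.trans ?_
    rw [Pi.add_apply, e1, e2]
    simp [voice]
  smul_mem' := fun c a ha p => by
    filter_upwards [ha p, (weight_ac (β := β) (p : ℝ) S.w_continuous S.w_pos).ae_le
      (Lp.coeFn_smul c (a.2 p))] with x e1 e2
    refine e2.trans ?_
    rw [Pi.smul_apply, e1]
    simp [voice]

/-- An `L_p` limit is an almost everywhere limit along a subsequence, while convergence in `H` gives
pointwise convergence of transforms. Closedness lets the `L_p` components of a Bochner integral be
identified through its component in `H`. -/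
theorem isClosed_graph (s : Finset {p : ℝ // 1 < p}) :
    IsClosed (S.graph s : Set (S.Ambient s)) := by
  refine IsSeqClosed.isClosed fun a b ha hab p => ?_
  have h1 : Tendsto (fun k => (a k).1) atTop (𝓝 b.1) := (continuous_fst.tendsto b).comp hab
  have h2 : Tendsto (fun k => (a k).2 p) atTop (𝓝 (b.2 p)) :=
    (((continuous_apply p).comp continuous_snd).tendsto b).comp hab
  obtain ⟨ns, hns, hlim⟩ := (tendstoInMeasure_of_tendsto_Lp h2).exists_seq_tendsto_ae
  filter_upwards [(weight_ac (β := β) (p : ℝ) S.w_continuous S.w_pos).ae_le hlim,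
    ae_all_iff.2 fun k => ha k p] with x e1 e2
  refine tendsto_nhds_unique e1 ?_
  simp only [e2]
  exact ((continuous_const.inner continuous_id).tendsto b.1).comp (h1.comp hns.tendsto_atTop)

theorem memLpw_voice (v : S.TestSpace) (p : {p : ℝ // 1 < p}) :
    MemLpw β (p : ℝ) S.w (S.voice (S.incl v)) := v.2 p.1 p.2

/-- The test space as a subspace of the ambient space. -/
noncomputable def toAmbient (s : Finset {p : ℝ // 1 < p}) : S.TestSpace →ₗ[ℂ] S.Ambient s where
  toFun v := (S.incl v, fun p => MemLp.toLp _ (S.memLpw_voice v p))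
  map_add' a b := by
    refine Prod.ext (map_add _ _ _) (funext fun p => ?_)
    refine Eq.trans ?_ (MemLp.toLp_add (S.memLpw_voice a p) (S.memLpw_voice b p))
    exact MemLp.toLp_congr (S.memLpw_voice (a + b) p) _
      (Eventually.of_forall fun x => by simp [voice])
  map_smul' c a := by
    refine Prod.ext (map_smul _ _ _) (funext fun p => ?_)
    refine Eq.trans ?_ (MemLp.toLp_const_smul c (S.memLpw_voice a p))
    exact MemLp.toLp_congr (S.memLpw_voice (c • a) p) _
      (Eventually.of_forall fun x => by simp [voice])

theorem toAmbient_mem_graph (s : Finset {p : ℝ // 1 < p}) (v : S.TestSpace) :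
    S.toAmbient s v ∈ S.graph s := fun p =>
  (weight_ac (β := β) (p : ℝ) S.w_continuous S.w_pos).ae_le
    (MemLp.coeFn_toLp (S.memLpw_voice v p))

theorem toAmbient_injective (s : Finset {p : ℝ // 1 < p}) :
    Function.Injective (S.toAmbient s) := fun _ _ h => Subtype.ext (congrArg Prod.fst h)

theorem sup_testSeminorm_le (s : Finset {p : ℝ // 1 < p}) (v : S.TestSpace) :
    s.sup (fun p => S.testSeminorm p) v ≤ ‖S.toAmbient s v‖ := by
  refine Seminorm.finset_sup_apply_le (norm_nonneg _) fun p hp => ?_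
  have h1 : S.testSeminorm p v = ‖(S.toAmbient s v).2 ⟨p, hp⟩‖ :=
    (Lp.norm_toLp _ (S.memLpw_voice v p)).symm
  rw [h1]
  exact (norm_le_pi_norm _ _).trans (norm_snd_le _)

/-- A distribution extends to a continuous functional on some ambient space. -/
theorem exists_ambient_extension (T : S.TestDual) :
    ∃ (s : Finset {p : ℝ // 1 < p}) (φ : S.Ambient s →L[ℂ] ℂ),
      ∀ v, φ (S.toAmbient s v) = starRingEnd ℂ (T v) := by
  have hw : WithSeminorms (𝕜 := ℂ) (fun p => S.testSeminorm p) := ⟨rfl⟩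
  let q : Seminorm ℂ S.TestSpace := (normSeminorm ℂ ℂ).comp T.toLinearMap
  have hq : Continuous q := continuous_norm.comp T.continuous
  obtain ⟨s, C, -, hC⟩ := Seminorm.bound_of_continuous hw q hq
  have hbound : ∀ v, ‖T v‖ ≤ C * ‖S.toAmbient s v‖ := fun v =>
    (hC v).trans (mul_le_mul_of_nonneg_left (S.sup_testSeminorm_le s v) C.2)
  let e := LinearEquiv.ofInjective (S.toAmbient s) (S.toAmbient_injective s)
  let f : LinearMap.range (S.toAmbient s) →ₗ[ℂ] ℂ :=
    -- The conjugation turns the antilinear `T` into a linear functional, as Hahn–Banach requires.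
    { toFun := fun a => starRingEnd ℂ (T (e.symm a))
      map_add' := fun a b => by simp
      map_smul' := fun c a => by simp }
  have hf : ∀ a, ‖f a‖ ≤ C * ‖a‖ := fun a => by
    have h1 := hbound (e.symm a)
    have h2 : S.toAmbient s (e.symm a) = a := congrArg Subtype.val (e.apply_symm_apply a)
    rw [h2] at h1
    change ‖starRingEnd ℂ (T (e.symm a))‖ ≤ _
    rwa [RCLike.norm_conj]
  obtain ⟨φ, hφ, -⟩ := exists_extension_norm_eq (LinearMap.range (S.toAmbient s))
    (f.mkContinuous C hf)
  refine ⟨s, φ, fun v => ?_⟩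
  refine (hφ ⟨S.toAmbient s v, v, rfl⟩).trans ?_
  change starRingEnd ℂ (T (e.symm (e v))) = _
  rw [e.symm_apply_apply]

theorem continuous_toAmbient_testAtom (s : Finset {p : ℝ // 1 < p}) :
    Continuous fun y => S.toAmbient s (S.testAtom y) := by
  refine Continuous.prodMk (S.π_continuous S.u) (continuous_pi fun p => ?_)
  refine (S.continuous_translateK S.w_moderate (r := (p : ℝ))).congr fun y => ?_
  exact MemLp.toLp_congr _ _ (Eventually.of_forall fun x => (S.voice_π_u y x).symm)

/-- Hölder between `L_{r,m}` and `L_{r',w}`, possible because `w m ≥ m 1`. -/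
theorem integrable_extVoice_mul_K {m : G → ℝ} (hm : IsModerate S.w m) {r : ℝ} (hr : 1 < r)
    {T : S.TestDual} (hT : T ∈ S.Co m r) (x : G) :
    Integrable (fun y => S.extVoice T y * S.K (y⁻¹ * x)) β := by
  obtain ⟨r', hrr⟩ : ∃ r', r.HolderConjugate r' := ⟨_, Real.HolderConjugate.conjExponent hr⟩
  obtain ⟨hTm, hTn⟩ := (memLpw_iff (by linarith) hm.continuous.measurable hm.pos).1 hT
  have hK := memLpw_translate S.w_moderate hrr.symm.pos (S.kernel_mem r' hrr.symm.lt) x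
  obtain ⟨hKm, hKn⟩ := (memLpw_iff hrr.symm.pos S.w_continuous.measurable S.w_pos).1 hK
  have hKc : Continuous fun y => S.K (y⁻¹ * x) :=
    S.continuous_K.comp (continuous_inv.mul continuous_const)
  refine ⟨hTm.mul hKc.aestronglyMeasurable, ?_⟩
  have h := lintegral_mul_le_weightedNorm hrr S.w_continuous.measurable hm.continuous.measurable
    (hm.pos 1) (hm.one_le_mul S) (fun x => (hm.pos x).le) hKm.enorm hTm.enorm
  refine lt_of_le_of_lt (le_trans (le_of_eq (lintegral_congr fun y => ?_)) h)
    (ENNReal.mul_lt_top ENNReal.ofReal_lt_top (ENNReal.mul_lt_top hKn hTn))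
  rw [enorm_mul, ← S.enorm_K_inv, mul_inv_rev, inv_inv, mul_comm]
  rfl

theorem weightedNorm_translated_K_convolution_lt_top {p : ℝ} (hp : 1 < p) (x : G) :
    weightedNorm β p S.w (fun z => ∫⁻ y, ‖S.K (x⁻¹ * y)‖ₑ * ‖S.K (y⁻¹ * z)‖ₑ ∂β) < ∞ := by
  have hp0 : 0 < p := by linarith
  have h1 : ∀ z, ∫⁻ y, ‖S.K (x⁻¹ * y)‖ₑ * ‖S.K (y⁻¹ * z)‖ₑ ∂β =
      ∫⁻ y, ‖S.K y‖ₑ * ‖S.K (y⁻¹ * (x⁻¹ * z))‖ₑ ∂β := fun z => by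
    rw [← lintegral_mul_left_eq_self _ x]
    simp [mul_assoc]
  simp only [h1]
  refine lt_of_le_of_lt ?_ (ENNReal.mul_lt_top (ENNReal.ofReal_lt_top (r := S.w x))
    (S.weightedNorm_K_convolution_lt_top hp))
  rw [← weightedNorm_const_mul hp0 ENNReal.ofReal_ne_top, weightedNorm, weightedNorm,
    ← lintegral_mul_left_eq_self _ x]
  refine ENNReal.rpow_le_rpow (lintegral_mono fun z => ENNReal.rpow_le_rpow ?_ hp0.le)
    (by positivity)
  simp only [inv_mul_cancel_left]
  refine (mul_le_mul_left (ENNReal.ofReal_le_ofReal (S.w_mul x z)) _).trans (le_of_eq ?_)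
  rw [ENNReal.ofReal_mul (S.w_pos x).le]
  ring

variable [CompleteSpace H]

theorem voice_integral {f : G → H} {A : Set G} (hf : IntegrableOn f A β) (z : G) :
    S.voice (∫ y in A, f y ∂β) z = ∫ y in A, S.voice (f y) z ∂β :=
  ((innerSL ℂ (S.π z S.u)).integral_comp_comm hf).symm

/-- The truncated integrals `∫_A K (x⁻¹ y) π(y) u dy` converge to `π(x) u`. -/
theorem tendsto_ambient_integral (s : Finset {p : ℝ // 1 < p}) (x : G) :
    Tendsto (fun k => ∫ y in compactCovering G k,
      S.K (x⁻¹ * y) • S.toAmbient s (S.testAtom y) ∂β) atTop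
      (𝓝 (S.toAmbient s (S.testAtom x))) := by
  set A : ℕ → Set G := fun k => compactCovering G k with hA
  have hAc : ∀ k, IsCompact (A k) := isCompact_compactCovering G
  have hAm : ∀ k, MeasurableSet (A k) := fun k => (hAc k).isClosed.measurableSet
  have hKx : Continuous fun y => S.K (x⁻¹ * y) := S.continuous_K.comp (continuous_const_mul x⁻¹)
  set γ : G → S.Ambient s := fun y => S.K (x⁻¹ * y) • S.toAmbient s (S.testAtom y) with hγ
  have hγc : Continuous γ := hKx.smul (S.continuous_toAmbient_testAtom s)
  have hγi : ∀ k, IntegrableOn γ (A k) β := fun k => hγc.continuousOn.integrableOn_compact (hAc k)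
  set e : ℕ → S.Ambient s := fun k => ∫ y in A k, γ y ∂β with he
  have hmem : ∀ k, e k ∈ S.graph s := fun k => integral_mem_of_isClosed _ (S.isClosed_graph s)
    (hγi k) fun y => Submodule.smul_mem _ _ (S.toAmbient_mem_graph s _)
  have hKK : ∀ y z, S.voice (γ y).1 z = S.K (x⁻¹ * y) * S.K (y⁻¹ * z) := fun y z => by
    change inner ℂ (S.π z S.u) (S.K (x⁻¹ * y) • S.π y S.u) = _
    rw [inner_smul_right, S.K_inv_mul z y]
  have hvoice : ∀ k z, S.voice (e k).1 z = ∫ y in A k, S.K (x⁻¹ * y) * S.K (y⁻¹ * z) ∂β :=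
    fun k z => by
      have h1 : (e k).1 = ∫ y in A k, (γ y).1 ∂β := fst_integral (hγi k)
      rw [h1, S.voice_integral (hγi k).fst]
      simp only [hKK]
  have hint : ∀ z, Integrable (fun y => S.K (x⁻¹ * y) * S.K (y⁻¹ * z)) β := fun z => by
    simpa only [S.voice_π_u] using S.integrable_voice_mul_K (S.π x S.u) z
  have hlimit : ∀ z, S.voice (S.π x S.u) z = ∫ y, S.K (x⁻¹ * y) * S.K (y⁻¹ * z) ∂β := fun z => by
    simpa only [S.voice_π_u] using S.voice_eq_integral (S.π x S.u) z
  set Λ : G → ℝ≥0∞ := fun z => ∫⁻ y, ‖S.K (x⁻¹ * y)‖ₑ * ‖S.K (y⁻¹ * z)‖ₑ ∂β with hΛ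
  -- A majorant independent of `k`: `Λ` is a translate of `|K| * |K|`, hence in every `L_{p,w}` with
  -- `p > 1`.
  have hle : ∀ k z, ‖S.voice (e k).1 z - S.voice (S.π x S.u) z‖ₑ ≤ 2 * Λ z := fun k z => by
    have h1 : ‖S.voice (e k).1 z‖ₑ ≤ Λ z := by
      rw [hvoice]
      refine (enorm_integral_le_lintegral_enorm _).trans ?_
      refine (setLIntegral_le_lintegral _ _).trans (le_of_eq (lintegral_congr fun y => ?_))
      exact enorm_mul _ _
    have h2 : ‖S.voice (S.π x S.u) z‖ₑ ≤ Λ z := by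
      rw [hlimit]
      refine (enorm_integral_le_lintegral_enorm _).trans (le_of_eq (lintegral_congr fun y => ?_))
      exact enorm_mul _ _
    rw [two_mul]
    exact enorm_sub_le.trans (add_le_add h1 h2)
  have hpt : ∀ z, Tendsto (fun k => ‖S.voice (e k).1 z - S.voice (S.π x S.u) z‖ₑ) atTop (𝓝 0) :=
    fun z => by
      have h1 := tendsto_setIntegral_of_monotone (μ := β) hAm
        (monotone_nat_of_le_succ fun k => compactCovering_subset G k.le_succ)
        (hint z).integrableOn
      have hU : ⋃ k, A k = univ := iUnion_compactCovering G
      rw [hU, setIntegral_univ, ← hlimit] at h1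
      simp only [← hvoice] at h1
      have h2 := (h1.sub_const (S.voice (S.π x S.u) z)).enorm
      simpa using h2
  have hw := S.w_continuous.measurable
  have hnorm : ∀ p : ℝ, 1 < p → Tendsto (fun k => weightedNorm β p S.w fun z =>
      ‖S.voice (e k).1 z - S.voice (S.π x S.u) z‖ₑ) atTop (𝓝 0) := fun p hp => by
    have hp0 : 0 < p := by linarith
    refine tendsto_weightedNorm_zero hp0 hw (Eventually.of_forall fun k => ?_) ?_
      (Eventually.of_forall fun k => Eventually.of_forall (hle k)) (Eventually.of_forall hpt)
    · exact ((S.continuous_voice _).sub (S.continuous_voice _)).measurable.enorm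
    · rw [weightedNorm_const_mul hp0 (by simp)]
      exact ENNReal.mul_lt_top (by simp) (S.weightedNorm_translated_K_convolution_lt_top hp x)
  refine (Prod.tendsto_iff _ _).2 ⟨?_, tendsto_pi_nhds.2 fun p => ?_⟩
  -- The norm of `H` is the `L_2` norm of the transform, which `w ≥ 1` bounds by the `L_{2,w}` norm.
  · rw [tendsto_iff_edist_tendsto_0]
    refine tendsto_of_tendsto_of_tendsto_of_le_of_le tendsto_const_nhds
      (hnorm 2 one_lt_two) (fun k => zero_le) fun k => ?_
    change edist (e k).1 (S.π x S.u) ≤ _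
    rw [edist_eq_enorm_sub, ← S.isometry, ← ENNReal.ofReal_ofNat,
      eLpNorm_eq_weightedNorm_one two_pos]
    refine ENNReal.rpow_le_rpow (lintegral_mono fun z => ENNReal.rpow_le_rpow ?_ two_pos.le)
      (by positivity)
    dsimp only
    rw [inner_sub_right]
    exact mul_le_mul_left (ENNReal.ofReal_le_ofReal (S.one_le_w z)) _
  · rw [Lp.tendsto_Lp_iff_tendsto_eLpNorm']
    refine (hnorm p p.1.2).congr fun k => ?_
    have hp0 : 0 < (p : ℝ) := zero_lt_one.trans p.1.2
    rw [← eLpNorm_weightedMeasure hp0 hw fun x => (S.w_pos x).le]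
    refine eLpNorm_congr_ae ?_
    have h1 := (hmem k p).sub (S.toAmbient_mem_graph s (S.testAtom x) p)
    exact EventuallyEq.symm (weightedMeasure_ac.ae_le h1)

/-- The reproducing formula for the extended voice transform. -/
theorem extVoice_eq_integral {m : G → ℝ} (hm : IsModerate S.w m) {r : ℝ} (hr : 1 < r)
    {T : S.TestDual} (hT : T ∈ S.Co m r) (x : G) :
    ∫ y, S.extVoice T y * S.K (y⁻¹ * x) ∂β = S.extVoice T x := by
  obtain ⟨s, φ, hφ⟩ := S.exists_ambient_extension T
  have h1 := (φ.continuous.tendsto _).comp (S.tendsto_ambient_integral s x)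
  rw [hφ] at h1
  have h2 : ∀ k, φ (∫ y in compactCovering G k,
      S.K (x⁻¹ * y) • S.toAmbient s (S.testAtom y) ∂β) =
      starRingEnd ℂ (∫ y in compactCovering G k, S.extVoice T y * S.K (y⁻¹ * x) ∂β) := fun k => by
    have hc : Continuous fun y => S.K (x⁻¹ * y) • S.toAmbient s (S.testAtom y) :=
      (S.continuous_K.comp (continuous_const_mul x⁻¹)).smul (S.continuous_toAmbient_testAtom s)
    -- Continuity of `φ` moves it inside the Bochner integral, where `φ` on a test atom is the
    -- conjugate of `V_e T`.
    rw [← φ.integral_comp_comm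
      (hc.continuousOn.integrableOn_compact (isCompact_compactCovering G k)), ← integral_conj]
    refine integral_congr_ae (Eventually.of_forall fun y => ?_)
    dsimp only
    rw [map_smul, hφ, map_mul, ← S.K_inv, mul_inv_rev, inv_inv, smul_eq_mul, mul_comm]
    rfl
  have h3 := tendsto_setIntegral_of_monotone (μ := β)
    (fun k => (isCompact_compactCovering G k).isClosed.measurableSet)
    (monotone_nat_of_le_succ fun k => compactCovering_subset G k.le_succ)
    (S.integrable_extVoice_mul_K hm hr hT x).integrableOn
  rw [iUnion_compactCovering, setIntegral_univ] at h3
  have h4 := (Complex.continuous_conj.tendsto _).comp h3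
  have h5 := tendsto_nhds_unique (h1.congr h2) h4
  exact ((starRingEnd ℂ).injective h5).symm

theorem toLp_extVoice_mem_kernelSpace {m : G → ℝ} (hm : IsModerate S.w m) {r : ℝ}
    [hr : Fact (1 < r)] {T : S.TestDual} (hT : T ∈ S.Co m r) :
    (MemLp.toLp _ hT : Lpw β r m) ∈ S.kernelSpace m r := by
  have hf : (MemLp.toLp _ hT : Lpw β r m) =ᵐ[β] S.extVoice T :=
    (weight_ac r hm.continuous hm.pos).ae_le (MemLp.coeFn_toLp hT)
  have hx : ∀ x, (fun y => (MemLp.toLp _ hT : Lpw β r m) y * S.K (y⁻¹ * x)) =ᵐ[β]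
      fun y => S.extVoice T y * S.K (y⁻¹ * x) := fun x => by
    filter_upwards [hf] with y hy
    rw [hy]
  refine ⟨Eventually.of_forall fun x =>
    (S.integrable_extVoice_mul_K hm hr.out hT x).congr (hx x).symm, ?_⟩
  filter_upwards [hf] with x h
  rw [h, integral_congr_ae (hx x), S.extVoice_eq_integral hm hr.out hT]

end Setting

end Reproducing

end Coorbit

theorem theorem3 {G : Type*} [Group G] [TopologicalSpace G] [IsTopologicalGroup G] [T2Space G]
    [LocallyCompactSpace G] [SecondCountableTopology G] [MeasurableSpace G] [BorelSpace G]
    (β : Measure G) [β.IsHaarMeasure]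
    {H : Type*} [NormedAddCommGroup H] [InnerProductSpace ℂ H] [CompleteSpace H]
    [TopologicalSpace.SeparableSpace H]
    (S : Coorbit.Setting β H) (D : Coorbit.Discretization β)
    (m : G → ℝ) (hm : Coorbit.IsModerate S.w m) (r : ℝ) [Fact (1 < r)]
    -- the span of the left translates of `K` is dense in the reproducing kernel space
    (hdense : S.kernelSpace m r ⊆
      closure (Submodule.span ℂ (range (S.translateK hm r)) : Set (Coorbit.Lpw β r m)))
    (p : ℝ) (hp : 1 ≤ p) (hpr : p < r)
    (hK : Coorbit.MemLpw β p (S.twistedWeight p) S.K)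
    (hosc : ∀ n, Coorbit.MemLpw β p S.w (Coorbit.osc (D.Q n) S.K) ∧
      Coorbit.MemLpw β p (S.twistedWeight p) (Coorbit.osc (D.Q n) S.K)) :
    -- part (i): `N ε` depends on `T` and `ε` only, the coefficients `c` do not depend on `ε`
    (∀ T ∈ S.Co m r, ∃ N : ℝ → ℕ,
      ∀ R : (n : ℕ) → S.V D hm r n →ₗ[ℂ] Coorbit.Lpw β r m,
        (∀ n, S.toV D hm r n ∘ₗ R n = LinearMap.id) →
        ∃ c : (n : ℕ) → D.X n → ℂ, ∀ ε : ℝ, 0 < ε → ∀ n ≥ N ε,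
          T - ∑ x : D.X n, c n x • S.atom (x : G) ∈ S.Co m r ∧
          S.coNorm m r (T - ∑ x : D.X n, c n x • S.atom (x : G)) ≤ ε ∧
          (∑ x : D.X n, (‖c n x‖ * m x) ^ r) ^ (1 / r) ≤
            S.constC D hm r (R n) * (1 + ε) * S.coNorm m r T) ∧
    -- part (ii): the series converges unconditionally, weakly and in the norm of `Co(L_{r,m})`
    (∀ q : ℝ, 1 / q + 1 / p = 1 + 1 / r → ∀ (n : ℕ) (d : D.Y n → ℂ), Coorbit.MemSeq m q d →
      ∃ T ∈ S.Co m r,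
        (∀ v : S.TestSpace, HasSum (fun x : D.Y n => d x * S.atom (x : G) v) (T v)) ∧
        Tendsto (fun s : Finset (D.Y n) => S.coNorm m r (T - ∑ x ∈ s, d x • S.atom (x : G)))
          atTop (𝓝 0) ∧
        S.coNorm m r T ≤ S.constD D p q n * Coorbit.seqNorm m q d) := by
  refine ⟨fun T hT => S.approximation D hm hT (hdense (S.toLp_extVoice_mem_kernelSpace hm hT)),
    fun q h n d hd => S.synthesis D hm Fact.out hp hpr hK (hosc n) h hd⟩
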